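/- Let $(\mathcal C,\otimes,1)$ be a closed symmetric monoidal abelian category having all small limits and colimits, such that small filtered colimits commute with finite limits in $A\text{-}\mathrm{Mod}$ for every commutative monoid object $A$ of $\mathcal C$ (here $A\text{-}\mathrm{Mod}$ is the category of $A$-modules in $\mathcal C$). An object $M$ of $\mathcal C$, or of $A\text{-}\mathrm{Mod}$, is called finitely generated if for every small filtered system of monomorphisms $(M_i)_{i\in I}$ in that category the canonical map $\operatorname{colim}_i\mathrm{Hom}(M,M_i)\to\mathrm{Hom}(M,\operatorname{colim}_i M_i)$ is bijective. Assume (C1) every object of $\mathcal C$ is the (small) directed colimit of its finitely generated subobjects. Write $\mathrm{Comm}(\mathcal C)$ for the category of commutative monoid objects in $\mathcal C$, $\mathrm{Aff}_{\mathcal C}=\mathrm{Comm}(\mathcal C)^{op}$ and $\mathrm{Spec}(A)$ for the object of $\mathrm{Aff}_{\mathcal C}$ given by $A$. A morphism $\mathrm{Spec}(B)\to \mathrm{Spec}(A)$ is a Zariski open immersion if $A\to B$ is an epimorphism in $\mathrm{Comm}(\mathcal C)$ which is flat ($-\otimes_AB:A\text{-}\mathrm{Mod}\to B\text{-}\mathrm{Mod}$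 is exact) and of finite presentation ($\mathrm{Hom}(B,-)$ preserves small filtered colimits of commutative $A$-algebras). A family of Zariski open immersions $\{\mathrm{Spec}(A_i)\to\mathrm{Spec}(A)\}_{i\in I}$ is a covering if there is a finite $J\subseteq I$ such that a morphism $f$ of $A\text{-}\mathrm{Mod}$ is an isomorphism if and only if $f\otimes_AA_j$ is one for all $j\in J$. Let $Sh(\mathrm{Aff}_{\mathcal C})$ be the category of sheaves of sets for the resulting topology. A subsheaf of $\mathrm{Spec}(A)$ is a Zariski open if it is the image of $\coprod_i X_i\to \mathrm{Spec}(A)$ for some family of Zariski open immersions $X_i\to\mathrm{Spec}(A)$ of affine schemes; a morphism $F\to G$ of sheaves is a Zariski open immersion if for every $Y=\mathrm{Spec}(A)\to G$ the projection $F\times_GY\to Y$ is a monomorphism whose image is a Zariski open of $Y$. For a sheaf $X$, let $\mathrm{ZarAff}(X)$ be the category of Zariski open immersions $U\to X$ with $U$ affine (morphisms over $X$). An affine cover of $X$ is a family $\{U_i\to X\}$ in $\mathrm{ZarAff}(X)$ such that $\coprod_iU_i\to X$ is an epimorphism of sheaves. $X$ is a scheme over $(\mathcal C,\otimes,1)$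 if it has an affine cover; it is quasi-compact if every affine cover has a finite subcover, and semi-separated if $U\times_XV\in\mathrm{ZarAff}(X)$ for all $U,V\in\mathrm{ZarAff}(X)$. Put $\mathcal O_X(U)=A$ for $(U=\mathrm{Spec}(A)\to X)\in \mathrm{ZarAff}(X)$. A quasi-coherent sheaf $\mathcal M$ on $X$ consists of an $\mathcal O_X(U)$-module $\mathcal M(U)$ for each $U\in \mathrm{ZarAff}(X)$ and, functorially in $U'\to U$, of $\mathcal O_X(U)$-linear maps $\mathcal M(U)\to\mathcal M(U')$ such that the induced maps $\mathcal O_X(U')\otimes_{\mathcal O_X(U)}\mathcal M(U)\to\mathcal M(U')$ are isomorphisms. Morphisms of quasi-coherent sheaves are families of $\mathcal O_X(U)$-linear maps compatible with restriction; a quasi-coherent submodule of $\mathcal M$ is a subobject in the resulting category $\mathrm{QCoh}(X)$. $\mathcal M$ is finitely generated if $\mathcal M(U)$ is a finitely generated $\mathcal O_X(U)$-module for every $U\in\mathrm{ZarAff}(X)$. **Theorem 3.8.** Let $X$ be a quasi-compact and semi-separated scheme over $(\mathcal C,\otimes,1)$ and let $\mathcal M$ be a quasi-coherent sheaf on $X$.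 Then $\mathcal M$ is the filtered direct limit of its finitely generated quasi-coherent submodules: ordered by inclusion, these form a filtered system with a small cofinal subsystem, and their inclusions exhibit $\mathcal M$ as the colimit of this system in $\mathrm{QCoh}(X)$. -/

import Mathlib

open CategoryTheory Limits MonoidalCategory Opposite

set_option linter.unusedSectionVars false

universe w v u

noncomputable section

namespace RelScheme

/-! ### Finitely generated objects and directed colimits of subobjects -/

section Subobjects

variable {D : Type u} [Category.{v} D]

/-- An object `M` is finitely generated if, for every (small) filtered system of monomorphisms
`(M_i)`, the canonical map `colim Hom(M, M_i) ⟶ Hom(M, colim M_i)` is bijective. -/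
def IsFinitelyGenerated : ObjectProperty D := fun M =>
  ∀ (J : Type v) [SmallCategory J] [IsFiltered J] (F : J ⥤ D),
    (∀ (i j : J) (f : i ⟶ j), Mono (F.map f)) → PreservesColimit F (coyoneda.obj (op M))

/-- The subobjects of `M` having the property `P`, ordered by inclusion. -/
abbrev SubobjectsWith (P : ObjectProperty D) (M : D) :=
  ObjectProperty.FullSubcategory (fun S : Subobject M => P (S : D))

/-- The tautological diagram formed by the subobjects of `M` having the property `P`. -/
abbrev subobjectsWithDiagram (P : ObjectProperty D) (M : D) : SubobjectsWith P M ⥤ D :=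
  ObjectProperty.ι (fun S : Subobject M => P (S : D)) ⋙ Subobject.underlying

/-- The cocone with vertex `M` given by the inclusions of the subobjects with property `P`. -/
@[simps]
def subobjectsWithCocone (P : ObjectProperty D) (M : D) : Cocone (subobjectsWithDiagram P M) where
  pt := M
  ι := { app := fun S => S.obj.arrow }

/-- `M` is the filtered direct limit of its subobjects with property `P`: these subobjects form
a filtered (i.e. directed and nonempty) system, a `w`-small subsystem is cofinal, and the
inclusions into `M` exhibit `M` as the colimit. -/
structure IsDirectedColimitOfSubobjects (P : ObjectProperty D) (M : D) : Prop where
  isFiltered : IsFiltered (SubobjectsWith P M)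
  finallySmall : FinallySmall.{w} (SubobjectsWith P M)
  isColimit : Nonempty (IsColimit (subobjectsWithCocone P M))

end Subobjects

variable {C : Type u} [Category.{v} C] [MonoidalCategory C] [SymmetricCategory C]

/-! ### Extension of scalars -/

section Scalars

/-- The category `A-Mod` of modules over a commutative monoid object `A`. -/
abbrev ModOver (A : CommMon C) := Mod C A.X

/-- The morphism of `C` underlying a morphism of commutative monoid objects. -/
def homX {A B : CommMon C} (f : A ⟶ B) : A.X ⟶ B.X := f.hom.hom

instance {A B : CommMon C} (f : A ⟶ B) : IsMonHom (homX f) :=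
  f.hom.isMonHom_hom

/-- Restriction of scalars `B-Mod ⥤ A-Mod` along `f : A ⟶ B`. -/
abbrev restrictScalars {A B : CommMon C} (f : A ⟶ B) : ModOver B ⥤ ModOver A :=
  Mod.comap (homX f)

variable [MonoidalClosed C] [HasColimits C]

open MonObj ModObj

variable {A B : CommMon C} (f : A ⟶ B) (M : ModOver A)

/-- The right action of `A` on `B`, tensored with `M`. -/
abbrev extLeft : (B.X ⊗ A.X) ⊗ M.X ⟶ B.X ⊗ M.X :=
  (B.X ◁ homX f ≫ μ[B.X]) ▷ M.X

/-- The left action of `A` on `M`, tensored with `B`. -/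
abbrev extRight {A B : CommMon C} (_f : A ⟶ B) (M : ModOver A) :
    (B.X ⊗ A.X) ⊗ M.X ⟶ B.X ⊗ M.X :=
  (α_ B.X A.X M.X).hom ≫ B.X ◁ (γ[A.X, M.X] : A.X ⊗ M.X ⟶ M.X)

/-- The object underlying `B ⊗_A M`, the coequalizer of `B ⊗ A ⊗ M ⇉ B ⊗ M`. -/
def extX : C := coequalizer (extLeft f M) (extRight f M)

/-- The projection `B ⊗ M ⟶ B ⊗_A M`. -/
def extπ : B.X ⊗ M.X ⟶ extX f M := coequalizer.π _ _

lemma extπ_condition : extLeft f M ≫ extπ f M = extRight f M ≫ extπ f M :=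
  coequalizer.condition _ _

instance : Epi (extπ f M) := inferInstanceAs (Epi (coequalizer.π _ _))

/-- Descent along `B ⊗ M ⟶ B ⊗_A M`. -/
def extDesc {Y : C} (k : B.X ⊗ M.X ⟶ Y) (h : extLeft f M ≫ k = extRight f M ≫ k) :
    extX f M ⟶ Y := coequalizer.desc k h

lemma extπ_desc {Y : C} (k : B.X ⊗ M.X ⟶ Y) (h : extLeft f M ≫ k = extRight f M ≫ k) :
    extπ f M ≫ extDesc f M k h = k := coequalizer.π_desc _ _

instance (Z : C) : PreservesColimitsOfSize.{v, v} (tensorLeft Z) :=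
  (ihom.adjunction Z).leftAdjoint_preservesColimits

instance (Z : C) : Epi (Z ◁ extπ f M) :=
  inferInstanceAs (Epi ((tensorLeft Z).map (extπ f M)))

/-- The action of `B` on `B ⊗_A M`, induced by the multiplication of `B`. -/
def extSmul : B.X ⊗ extX f M ⟶ extX f M :=
  Cofork.IsColimit.desc
    (isColimitOfHasCoequalizerOfPreservesColimit (tensorLeft B.X) (extLeft f M) (extRight f M))
    ((α_ _ _ _).inv ≫ μ[B.X] ▷ M.X ≫ extπ f M) (by
      have h := extπ_condition f M
      have h1 : (α_ B.X (B.X ⊗ A.X) M.X).inv ≫ (α_ B.X B.X A.X).inv ▷ M.X ≫ μ[B.X] ▷ A.X ▷ M.X ≫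
          extLeft f M = B.X ◁ extLeft f M ≫ (α_ _ _ _).inv ≫ μ[B.X] ▷ M.X := by
        have e : (α_ B.X B.X A.X).inv ≫ μ[B.X] ▷ A.X ≫ B.X ◁ homX f ≫ μ[B.X] =
            B.X ◁ (B.X ◁ homX f ≫ μ[B.X]) ≫ μ[B.X] := by
          rw [← whisker_exchange_assoc, MonObj.mul_assoc]
          simp
        simp only [extLeft, ← comp_whiskerRight, e]
        simp
      have h2 : (α_ B.X (B.X ⊗ A.X) M.X).inv ≫ (α_ B.X B.X A.X).inv ▷ M.X ≫ μ[B.X] ▷ A.X ▷ M.X ≫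
          extRight f M = B.X ◁ extRight f M ≫ (α_ _ _ _).inv ≫ μ[B.X] ▷ M.X := by
        simp only [extRight, whiskerLeft_comp, Category.assoc]
        rw [associator_naturality_left_assoc, ← whisker_exchange]
        simp
      change B.X ◁ extLeft f M ≫ _ = B.X ◁ extRight f M ≫ _
      rw [← reassoc_of% h1, h]
      have h3 := congrArg (· ≫ extπ f M) h2
      simp only [Category.assoc] at h3
      simpa only [extRight, Category.assoc] using h3)

lemma whiskerLeft_extπ_extSmul :
    B.X ◁ extπ f M ≫ extSmul f M = (α_ _ _ _).inv ≫ μ[B.X] ▷ M.X ≫ extπ f M :=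
  Cofork.IsColimit.π_desc' (isColimitOfHasCoequalizerOfPreservesColimit (tensorLeft B.X)
    (extLeft f M) (extRight f M)) _ _

/-- Extension of scalars `B ⊗_A M` of an `A`-module `M`, as a `B`-module. -/
def extObj : ModOver B where
  X := extX f M
  mod :=
    { smul := extSmul f M
      one_smul := by
        have h : B.X ◁ extπ f M ≫ extSmul f M = _ := whiskerLeft_extπ_extSmul f M
        change η[B.X] ▷ extX f M ≫ extSmul f M = (λ_ (extX f M)).hom
        rw [← cancel_epi (𝟙_ C ◁ extπ f M), whisker_exchange_assoc, h,
          leftUnitor_naturality]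
        simp only [associator_inv_naturality_left_assoc, ← comp_whiskerRight_assoc,
          MonObj.one_mul]
        simp
      mul_smul := by
        have h := whiskerLeft_extπ_extSmul f M
        change μ[B.X] ▷ extX f M ≫ extSmul f M =
          (α_ B.X B.X (extX f M)).hom ≫ B.X ◁ extSmul f M ≫ extSmul f M
        rw [← cancel_epi ((B.X ⊗ B.X) ◁ extπ f M), whisker_exchange_assoc, h]
        simp only [associator_naturality_right_assoc, ← whiskerLeft_comp_assoc, h]
        simp only [whiskerLeft_comp, Category.assoc, h]
        simp only [associator_inv_naturality_left_assoc, associator_inv_naturality_middle_assoc,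
          ← comp_whiskerRight_assoc, MonObj.mul_assoc]
        simp }

lemma extObj_smul : (γ[B.X, (extObj f M).X] : B.X ⊗ extX f M ⟶ extX f M) = extSmul f M := rfl

/-- The canonical map `M ⟶ B ⊗_A M`. -/
def extUnit : M.X ⟶ extX f M := (λ_ M.X).inv ≫ η[B.X] ▷ M.X ≫ extπ f M

lemma smul_extUnit : (γ[A.X, M.X] : A.X ⊗ M.X ⟶ M.X) ≫ extUnit f M = homX f ▷ M.X ≫ extπ f M := by
  have hc : (B.X ◁ homX f ≫ μ[B.X]) ▷ M.X ≫ extπ f M =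
      (α_ B.X A.X M.X).hom ≫ B.X ◁ (γ[A.X, M.X] : A.X ⊗ M.X ⟶ M.X) ≫ extπ f M := by
    simpa using extπ_condition f M
  have h1 : homX f ▷ M.X =
      ((λ_ A.X).inv ≫ η[B.X] ▷ A.X) ▷ M.X ≫ (B.X ◁ homX f ≫ μ[B.X]) ▷ M.X := by
    rw [← comp_whiskerRight, Category.assoc, ← whisker_exchange_assoc, MonObj.one_mul]
    simp
  rw [h1, Category.assoc, hc, comp_whiskerRight, Category.assoc,
    associator_naturality_left_assoc, ← whisker_exchange_assoc]
  simp [extUnit]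

lemma whiskerLeft_extUnit_extSmul : B.X ◁ extUnit f M ≫ extSmul f M = extπ f M := by
  rw [extUnit, whiskerLeft_comp, whiskerLeft_comp, Category.assoc, Category.assoc,
    whiskerLeft_extπ_extSmul, associator_inv_naturality_middle_assoc, ← comp_whiskerRight_assoc,
    MonObj.mul_one]
  simp

lemma extUnit_comp_linear (N : ModOver B) (g : extX f M ⟶ N.X)
    (hg : extSmul f M ≫ g = B.X ◁ g ≫ γ[B.X, N.X]) :
    (γ[A.X, M.X] : A.X ⊗ M.X ⟶ M.X) ≫ extUnit f M ≫ g =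
      A.X ◁ (extUnit f M ≫ g) ≫ homX f ▷ N.X ≫ γ[B.X, N.X] := by
  rw [reassoc_of% (smul_extUnit f M), whisker_exchange_assoc, whiskerLeft_comp, Category.assoc, ← hg,
    reassoc_of% (whiskerLeft_extUnit_extSmul f M)]

lemma extDesc_cond (N : ModOver B) (h : M.X ⟶ N.X)
    (hh : (γ[A.X, M.X] : A.X ⊗ M.X ⟶ M.X) ≫ h = A.X ◁ h ≫ homX f ▷ N.X ≫ γ[B.X, N.X]) :
    extLeft f M ≫ B.X ◁ h ≫ γ[B.X, N.X] = extRight f M ≫ B.X ◁ h ≫ γ[B.X, N.X] := by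
  have h2 : B.X ◁ (γ[A.X, M.X] : A.X ⊗ M.X ⟶ M.X) ≫ B.X ◁ h =
      B.X ◁ A.X ◁ h ≫ B.X ◁ homX f ▷ N.X ≫ B.X ◁ γ[B.X, N.X] := by
    rw [← whiskerLeft_comp, hh]; simp
  rw [extLeft, extRight, Category.assoc, reassoc_of% h2, ← whisker_exchange_assoc,
    comp_whiskerRight, Category.assoc, ModObj.mul_smul_self]
  simp

lemma extDesc_linear (N : ModOver B) (h : M.X ⟶ N.X)
    (hc : extLeft f M ≫ B.X ◁ h ≫ γ[B.X, N.X] = extRight f M ≫ B.X ◁ h ≫ γ[B.X, N.X]) :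
    extSmul f M ≫ extDesc f M (B.X ◁ h ≫ γ[B.X, N.X]) hc =
      B.X ◁ extDesc f M (B.X ◁ h ≫ γ[B.X, N.X]) hc ≫ γ[B.X, N.X] := by
  rw [← cancel_epi (B.X ◁ extπ f M), reassoc_of% (whiskerLeft_extπ_extSmul f M), extπ_desc,
    ← whiskerLeft_comp_assoc, extπ_desc, ← whisker_exchange_assoc, ModObj.mul_smul_self]
  simp

lemma extDesc_extUnit (N : ModOver B) (g : extX f M ⟶ N.X)
    (hg : extSmul f M ≫ g = B.X ◁ g ≫ γ[B.X, N.X])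
    (hc : extLeft f M ≫ B.X ◁ (extUnit f M ≫ g) ≫ γ[B.X, N.X] =
      extRight f M ≫ B.X ◁ (extUnit f M ≫ g) ≫ γ[B.X, N.X]) :
    extDesc f M (B.X ◁ (extUnit f M ≫ g) ≫ γ[B.X, N.X]) hc = g := by
  rw [← cancel_epi (extπ f M), extπ_desc, whiskerLeft_comp, Category.assoc, ← hg,
    reassoc_of% (whiskerLeft_extUnit_extSmul f M)]

lemma extUnit_extDesc (N : ModOver B) (h : M.X ⟶ N.X)
    (hc : extLeft f M ≫ B.X ◁ h ≫ γ[B.X, N.X] = extRight f M ≫ B.X ◁ h ≫ γ[B.X, N.X]) :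
    extUnit f M ≫ extDesc f M (B.X ◁ h ≫ γ[B.X, N.X]) hc = h := by
  rw [extUnit, Category.assoc, Category.assoc, extπ_desc, ← whisker_exchange_assoc,
    ModObj.one_smul_self]
  simp

/-- `B`-linear maps `B ⊗_A M ⟶ N` correspond to `A`-linear maps `M ⟶ N`, by composition with the
canonical map `M ⟶ B ⊗_A M`. -/
def extHomEquiv (N : ModOver B) : (extObj f M ⟶ N) ≃ (M ⟶ (restrictScalars f).obj N) where
  toFun g := Mod.Hom.mk' (M := M) (N := (restrictScalars f).obj N)
    (extUnit f M ≫ (show extX f M ⟶ N.X from g.hom))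
    (extUnit_comp_linear f M N g.hom g.isModHom.smul_hom)
  invFun h := Mod.Hom.mk' (M := extObj f M) (N := N)
    (extDesc f M (B.X ◁ (show M.X ⟶ N.X from h.hom) ≫ γ[B.X, N.X])
      (extDesc_cond f M N h.hom h.isModHom.smul_hom))
    (extDesc_linear f M N h.hom (extDesc_cond f M N h.hom h.isModHom.smul_hom))
  left_inv g := by
    ext
    exact extDesc_extUnit f M N g.hom g.isModHom.smul_hom _
  right_inv h := by
    ext
    exact extUnit_extDesc f M N h.hom _

/-- The extension of scalars functor `B ⊗_A - : A-Mod ⥤ B-Mod`. -/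
def extendScalars : ModOver A ⥤ ModOver B :=
  Adjunction.leftAdjointOfEquiv (G := restrictScalars f) (extHomEquiv f) (by
    intro M N N' k g
    ext
    exact (Category.assoc (extUnit f M) (show extX f M ⟶ N.X from g.hom) k.hom).symm)

/-- Extension of scalars is left adjoint to restriction of scalars. -/
def extendRestrictAdj : extendScalars f ⊣ restrictScalars f :=
  Adjunction.adjunctionOfEquivLeft (G := restrictScalars f) (extHomEquiv f) _

end Scalars

/-! ### The Zariski topology on affine schemes -/

section Zariski

variable (C) in
/-- The category of affine schemes over `C`: the opposite of commutative monoid objects. -/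
abbrev Aff := (CommMon C)ᵒᵖ

variable [MonoidalClosed C] [HasColimits C]

/-- `A ⟶ B` is flat if `B ⊗_A - : A-Mod ⥤ B-Mod` is exact. As this functor is a left adjoint,
it is exact as soon as it preserves finite limits. -/
def IsFlat {A B : CommMon C} (f : A ⟶ B) : Prop := PreservesFiniteLimits (extendScalars f)

/-- A morphism `Spec B ⟶ Spec A` of affine schemes is a Zariski open immersion if the
corresponding `A ⟶ B` is a flat epimorphism of finite presentation in commutative monoid
objects; the latter means that `Hom(B, -)` preserves filtered colimits of commutative
`A`-algebras. -/
structure IsAffineOpenImmersion {V U : Aff C} (j : V ⟶ U) : Prop where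
  epi : Epi j.unop
  flat : IsFlat j.unop
  finitelyPresented : IsFinitelyPresentable.{v} (Under.mk j.unop)

variable (C) in
/-- The Zariski coverings of affine schemes: a family of Zariski open immersions
`Spec A_i ⟶ Spec A` is a covering if there are finitely many members such that the extension of
scalars functors to these `A_i` are jointly conservative on `A-Mod`. -/
def zariskiPrecoverage : Precoverage (Aff C) where
  coverings U := {R | (∀ (V : Aff C) (j : V ⟶ U), R j → IsAffineOpenImmersion j) ∧
    ∃ (n : ℕ) (V : Fin n → Aff C) (j : ∀ i, V i ⟶ U), (∀ i, R (j i)) ∧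
      ∀ (M N : ModOver U.unop) (φ : M ⟶ N),
        (∀ i, IsIso ((extendScalars (j i).unop).map φ)) → IsIso φ}

variable (C) in
/-- The Zariski topology on affine schemes. -/
def zariskiTopology : GrothendieckTopology (Aff C) := (zariskiPrecoverage C).toGrothendieck

/-- A sieve on an affine scheme `U` (a subfunctor of `U`) is a Zariski open of `U` if it is the
image, in the category of sheaves, of the union of a family of affine Zariski open immersions
into `U`; the image sheaf is the closure of the sieve generated by the family. -/
def IsZariskiOpen {U : Aff C} (S : Sieve U) : Prop :=
  ∃ R : Presieve U, (∀ (V : Aff C) (j : V ⟶ U), R j → IsAffineOpenImmersion j) ∧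
    S = (zariskiTopology C).close (Sieve.generate R)

/-- A morphism `f : F ⟶ G` (between sheaves) is a Zariski open immersion if for every affine
`U` and every section `s : U ⟶ G`, the projection `F ×_G U ⟶ U` is a monomorphism and its image,
the sieve of those `V ⟶ U` along which `s` lifts to `F`, is a Zariski open of `U`. (The
projections are all monomorphisms if and only if `f` is one.) -/
structure IsZariskiOpenImmersion {F G : (Aff C)ᵒᵖ ⥤ Type (max u v)} (f : F ⟶ G) : Prop where
  mono : Mono f
  isZariskiOpen : ∀ (U : Aff C) (s : G.obj (op U)), IsZariskiOpen (Presheaf.imageSieve f s)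

end Zariski

/-! ### Schemes -/

section Schemes

variable [MonoidalClosed C] [HasColimits C]

variable (C) in
/-- Zariski sheaves of sets on affine schemes. -/
abbrev ZariskiSheaf := Sheaf (zariskiTopology C) (Type (max u v))

/-- The category `ZarAff(X)` of Zariski open immersions `U ⟶ X` with `U` affine; the morphisms are
the morphisms over `X`. An affine scheme is viewed as the functor that it represents. -/
abbrev ZarAff (X : ZariskiSheaf C) :=
  ObjectProperty.FullSubcategory
    (fun U : CostructuredArrow (uliftYoneda.{u} (C := Aff C)) X.obj => IsZariskiOpenImmersion U.hom)

namespace ZarAff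

variable {X : ZariskiSheaf C}

/-- The open immersion `U ⟶ X` belonging to an object of `ZarAff(X)`. -/
abbrev imm (U : ZarAff X) : uliftYoneda.{u}.obj U.obj.left ⟶ X.obj := U.obj.hom

variable (X) in
/-- The structure sheaf `O_X : ZarAff(X)ᵒᵖ ⥤ Comm(C)`, sending `Spec A ⟶ X` to `A`. -/
def structureSheaf : (ZarAff X)ᵒᵖ ⥤ CommMon C :=
  (ObjectProperty.ι _ ⋙ CostructuredArrow.proj _ _).leftOp

end ZarAff

/-- A family `U_i ⟶ X` in `ZarAff(X)` is an affine cover of `X` if `∐ U_i ⟶ X` is an epimorphism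
of sheaves, i.e. if the `U_i ⟶ X` are jointly epimorphic with respect to sheaves. -/
def IsAffineCover (X : ZariskiSheaf C) {ι : Type w} (U : ι → ZarAff X) : Prop :=
  ∀ (Z : ZariskiSheaf C) (g h : X ⟶ Z),
    (∀ i, (U i).imm ≫ g.hom = (U i).imm ≫ h.hom) → g = h

/-- A sheaf is a scheme over `C` if it has an affine cover. -/
def IsScheme (X : ZariskiSheaf C) : Prop :=
  ∃ (ι : Type (max u v)) (U : ι → ZarAff X), IsAffineCover X U

/-- `X` is quasi-compact if every affine cover of `X` has a finite subcover. -/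
def IsQuasiCompact (X : ZariskiSheaf C) : Prop :=
  ∀ (ι : Type (max u v)) (U : ι → ZarAff X), IsAffineCover X U →
    ∃ s : Finset ι, IsAffineCover X (fun i : s => U i)

/-- `X` is semi-separated if for `U, V` in `ZarAff(X)`, the fiber product `U ×_X V` is again in
`ZarAff(X)`. -/
def IsSemiSeparated (X : ZariskiSheaf C) : Prop :=
  ∀ U V : ZarAff X, ∃ (W : ZarAff X) (p : W ⟶ U) (q : W ⟶ V),
    IsPullback (uliftYoneda.{u}.map p.hom.left) (uliftYoneda.{u}.map q.hom.left) U.imm V.imm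

end Schemes

/-! ### Quasi-coherent sheaves -/

section QuasiCoherent

variable [MonoidalClosed C] [HasColimits C]

/-- A quasi-coherent sheaf on `X`: an `O_X(U)`-module `M(U)` for each `U` in `ZarAff(X)` and,
functorially in `V ⟶ U`, an `O_X(U)`-linear map from `M(U)` to `M(V)` whose `O_X(V)`-linear
extension `O_X(V) ⊗_{O_X(U)} M(U) ⟶ M(V)` is an isomorphism. -/
structure QCoh (X : ZariskiSheaf C) where
  /-- The module of sections over `U`. -/
  obj (U : (ZarAff X)ᵒᵖ) : ModOver ((ZarAff.structureSheaf X).obj U)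
  /-- The restriction maps. -/
  map {U V : (ZarAff X)ᵒᵖ} (u : U ⟶ V) :
    obj U ⟶ (restrictScalars ((ZarAff.structureSheaf X).map u)).obj (obj V)
  map_id (U : (ZarAff X)ᵒᵖ) : (map (𝟙 U)).hom = 𝟙 (obj U).X
  map_comp {U V W : (ZarAff X)ᵒᵖ} (u : U ⟶ V) (v : V ⟶ W) :
    (map (u ≫ v)).hom =
      (show (obj U).X ⟶ (obj V).X from (map u).hom) ≫
        (show (obj V).X ⟶ (obj W).X from (map v).hom)
  isIso {U V : (ZarAff X)ᵒᵖ} (u : U ⟶ V) :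
    IsIso (((extendRestrictAdj ((ZarAff.structureSheaf X).map u)).homEquiv _ _).symm (map u))

namespace QCoh

variable {X : ZariskiSheaf C}

/-- A morphism of quasi-coherent sheaves: `O_X(U)`-linear maps commuting with restrictions. -/
@[ext]
structure Hom (M N : QCoh X) where
  /-- The map on sections over `U`. -/
  app (U : (ZarAff X)ᵒᵖ) : M.obj U ⟶ N.obj U
  naturality {U V : (ZarAff X)ᵒᵖ} (u : U ⟶ V) :
    M.map u ≫ (restrictScalars ((ZarAff.structureSheaf X).map u)).map (app V) = app U ≫ N.map u

instance : Category (QCoh X) where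
  Hom := Hom
  id M := { app := fun U => 𝟙 (M.obj U), naturality := by intros; simp }
  comp f g :=
    { app := fun U => f.app U ≫ g.app U
      naturality := by
        intro U V u
        rw [Functor.map_comp, reassoc_of% f.naturality u, g.naturality u, Category.assoc] }

/-- A quasi-coherent sheaf is finitely generated if each `M(U)` is a finitely generated
`O_X(U)`-module. -/
def IsFinitelyGenerated : ObjectProperty (QCoh X) := fun M =>
  ∀ U : (ZarAff X)ᵒᵖ, RelScheme.IsFinitelyGenerated (M.obj U)

end QCoh

end QuasiCoherent

end RelScheme

end

/-!
Let `M` be a quasi-coherent sheaf on a quasi-compact semi-separated scheme `X` and let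
`U_1, …, U_n` be a finite affine cover of `X`.

*Restriction is flat and local.* For `V' ⟶ V` in `ZarAff(X)`, the restriction `M(V) ⟶ M(V')` is a
flat base change (`ZarAff.isFlat`), so a submodule `S` of `M(V)` generates a submodule `res S` of
`M(V')` isomorphic to its extension of scalars, and `res` is left adjoint to the inverse image
`con` of submodules (`gc_res_con`). The extension of scalars functors to the `V ∩ U_i` are jointly
conservative on `O(V)`-modules: being conservative is stable under base change and composition, so
it passes from the generating coverings to all covering sieves (`isConservative_pullback`), and a
section of `X` lifts locally to the `U_i` (`IsAffineCover.liftSieve_mem`). Hence submodules of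
`M(V)` can be compared on the `V ∩ U_i` (`le_of_res_le`).

*Subobjects are compatible families.* Subobjects of `M` in `QCoh(X)` are the same as families of
submodules of the `M(V)` compatible with `res` (`QCoh.res_sec`, `QCoh.exists_sec_eq`,
`QCoh.le_iff_sec_le`).

*Cutting down a subobject.* For a subobject `S` of `M` and a submodule `T` of `S(U)`, the
submodules `S(V) ∩ con (res T)`, with `res T` taken on `U ∩ V`, form a compatible family with value
`T` on `U` (`QCoh.exists_sec_eq_of_le`). The compatibility is base change for the cocartesian squares
of rings coming from the intersections with `U` (`res_inf_con`), and this is where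
semi-separatedness enters. If `T` has the same restriction to `U ∩ V` as `S`, the sections over `V` do
not change.

*Finite generation.* If finitely many flat base changes of a module `S` are finitely generated,
then `S` has a finitely generated submodule with the same base changes, as `S` is the union of its
finitely generated submodules (`exists_isFinitelyGenerated_res_eq`). With joint conservativity this
shows that finite generation of a quasi-coherent sheaf can be checked on the `U_i`
(`QCoh.isFinitelyGenerated_of_cover`). It also shows that, starting from a finitely generated
submodule `T` of some `M(V)`, one can cut `M` down to have sections `T` on `V`, and then make the
result finitely generated on `U_1, …, U_n` in turn without disturbing the previous steps. So every
such `T` lies in the sections of a finitely generated quasi-coherent submodule of `M`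
(`QCoh.exists_isFinitelyGenerated`). Directedness, the small cofinal system and the universal
property of the colimit all follow from this, since each `M(V)` is the union of a small system of
finitely generated submodules.
-/

noncomputable section

namespace RelScheme

/-! ### The abelian category of modules over a monoid -/

section ActionMonad

variable {C : Type u} [Category.{v} C] [MonoidalCategory C]

/-- The monad `A ⊗ -` on `C` attached to a monoid object `A`. -/
def actionMonad (A : C) [MonObj A] : Monad C where
  toFunctor := tensorLeft A
  η := { app := fun X => (λ_ X).inv ≫ MonObj.one ▷ X
         naturality := fun X Y f => by simp [← whisker_exchange] }
  μ := { app := fun X => (α_ A A X).inv ≫ MonObj.mul ▷ X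
         naturality := fun X Y f => by
           simp [← whisker_exchange] }
  left_unit X := by
    change ((λ_ (A ⊗ X)).inv ≫ MonObj.one ▷ (A ⊗ X)) ≫ (α_ A A X).inv ≫ MonObj.mul ▷ X = 𝟙 _
    simp [← comp_whiskerRight]
  right_unit X := by
    change A ◁ ((λ_ X).inv ≫ MonObj.one ▷ X) ≫ (α_ A A X).inv ≫ MonObj.mul ▷ X = 𝟙 _
    simp only [whiskerLeft_comp,
      Category.assoc, associator_inv_naturality_middle_assoc, ← comp_whiskerRight, MonObj.mul_one]
    simp
  assoc X := by
    change A ◁ ((α_ A A X).inv ≫ MonObj.mul ▷ X) ≫ (α_ A A X).inv ≫ MonObj.mul ▷ X =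
      ((α_ A A (A ⊗ X)).inv ≫ MonObj.mul ▷ (A ⊗ X)) ≫ (α_ A A X).inv ≫ MonObj.mul ▷ X
    simp only [whiskerLeft_comp,
      Category.assoc, associator_inv_naturality_middle_assoc, ← comp_whiskerRight,
      associator_inv_naturality_left_assoc]
    rw [MonObj.mul_assoc_flip]
    simp

end ActionMonad

section ModuleCategory

open MonObj ModObj

variable {C : Type u} [Category.{v} C] [MonoidalCategory C]

variable (A : C) [MonObj A]

/-- Modules over `A` are algebras over the monad `A ⊗ -`. -/
def toAlgebra : Mod C A ⥤ (actionMonad A).Algebra where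
  obj M := { A := M.X
             a := (γ[A, M.X] : A ⊗ M.X ⟶ M.X)
             unit := by
               change ((λ_ M.X).inv ≫ η[A] ▷ M.X) ≫ _ = _
               rw [Category.assoc, one_smul_self]; simp
             assoc := by
               change ((α_ A A M.X).inv ≫ μ[A] ▷ M.X) ≫ _ = A ◁ _ ≫ _
               rw [Category.assoc, mul_smul_self]; simp }
  map f := { f := f.hom
             h := f.isModHom.smul_hom.symm }

/-- Algebras over the monad `A ⊗ -` are modules over `A`. -/
def ofAlgebra : (actionMonad A).Algebra ⥤ Mod C A where
  obj M :=
    { X := M.A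
      mod :=
      { smul := (M.a : A ⊗ M.A ⟶ M.A)
        one_smul := by
          exact ((Iso.inv_comp_eq _).1 ((Category.assoc _ _ _).symm.trans M.unit)).trans
            (Category.comp_id _)
        mul_smul := (Iso.inv_comp_eq _).1 ((Category.assoc _ _ _).symm.trans M.assoc) } }
  map f := Mod.Hom.mk' f.f f.h.symm

/-- The category of modules over `A` is the Eilenberg–Moore category of the monad `A ⊗ -`. -/
def modEquivAlgebra : Mod C A ≌ (actionMonad A).Algebra where
  functor := toAlgebra A
  inverse := ofAlgebra A
  unitIso := Iso.refl _
  counitIso := Iso.refl _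
  functor_unitIso_comp _ := by ext; exact Category.comp_id _

instance : (toAlgebra A).IsEquivalence := (modEquivAlgebra A).isEquivalence_functor

instance : (Mod.forget A : Mod C A ⥤ C).Faithful where
  map_injective h := Mod.hom_ext _ _ h

instance createsLimitsForget : CreatesLimitsOfSize.{v, v} (Mod.forget A : Mod C A ⥤ C) :=
  inferInstanceAs (CreatesLimitsOfSize.{v, v} (toAlgebra A ⋙ (actionMonad A).forget))

instance : (Mod.forget A : Mod C A ⥤ C).ReflectsIsomorphisms :=
  inferInstanceAs (toAlgebra A ⋙ (actionMonad A).forget).ReflectsIsomorphisms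

section Closed

variable [SymmetricCategory C] [MonoidalClosed C] [HasColimits C]

instance createsColimitsForget : CreatesColimitsOfSize.{v, v} (Mod.forget A : Mod C A ⥤ C) :=
  haveI : PreservesColimitsOfSize.{v, v} (actionMonad A).toFunctor :=
    inferInstanceAs (PreservesColimitsOfSize.{v, v} (tensorLeft A))
  inferInstanceAs (CreatesColimitsOfSize.{v, v} (toAlgebra A ⋙ (actionMonad A).forget))

instance [HasLimits C] : HasLimits (Mod C A) :=
  hasLimits_of_hasLimits_createsLimits (Mod.forget A)

instance : HasColimits (Mod C A) :=
  hasColimits_of_hasColimits_createsColimits (Mod.forget A)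

variable [Abelian C]

instance tensorLeft_preservesZeroMorphisms (Z : C) : (tensorLeft Z).PreservesZeroMorphisms :=
  haveI := (ihom.adjunction Z).isLeftAdjoint
  inferInstance

/-- As a left adjoint, `Z ⊗ -` preserves binary biproducts. -/
instance tensorLeft_additive (Z : C) : (tensorLeft Z).Additive :=
  haveI := (ihom.adjunction Z).isLeftAdjoint
  haveI : PreservesBinaryBiproducts (tensorLeft Z) :=
    preservesBinaryBiproducts_of_preservesBinaryCoproducts _
  Functor.additive_of_preservesBinaryBiproducts _

instance actionMonad_additive : (actionMonad A).toFunctor.Additive :=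
  inferInstanceAs (tensorLeft A).Additive

instance : Preadditive (Mod C A) :=
  .ofFullyFaithful (F := toAlgebra A) (.ofFullyFaithful _)

instance : (Mod.forget A : Mod C A ⥤ C).Additive :=
  haveI : (toAlgebra A).Additive :=
    (Functor.FullyFaithful.ofFullyFaithful (toAlgebra A)).additive_ofFullyFaithful
  inferInstanceAs (toAlgebra A ⋙ (actionMonad A).forget).Additive

/-- The forgetful functor preserves and reflects the comparison of coimages with images. -/
instance [HasLimits C] : Abelian (Mod C A) :=
  haveI (X Y : Mod C A) (f : X ⟶ Y) : IsIso (Abelian.coimageImageComparison f) := by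
    have : IsIso ((Mod.forget A).map (Abelian.coimageImageComparison f)) :=
      ((MorphismProperty.isomorphisms C).arrow_mk_iso_iff
        (Abelian.PreservesCoimageImageComparison.iso (Mod.forget A) f)).2
        (inferInstanceAs (IsIso _))
    exact isIso_of_reflects_iso _ (Mod.forget A)
  .ofCoimageImageComparisonIsIso

end Closed

end ModuleCategory

/-! ### Finitely generated objects in abelian categories with exact filtered colimits -/

section FinitelyGenerated

variable {D : Type u} [Category.{v} D]

lemma IsFinitelyGenerated.exists_factorization {M : D} (hM : IsFinitelyGenerated M)
    {J : Type v} [SmallCategory J] [IsFiltered J] {F : J ⥤ D}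
    (hF : ∀ (i j : J) (f : i ⟶ j), Mono (F.map f)) {c : Cocone F} (hc : IsColimit c)
    (g : M ⟶ c.pt) : ∃ (j : J) (h : M ⟶ F.obj j), h ≫ c.ι.app j = g := by
  have := hM J F hF
  exact Types.jointly_surjective_of_isColimit
    (isColimitOfPreserves (coyoneda.obj (op M)) hc) g

lemma IsFinitelyGenerated.of_iso {M N : D} (e : M ≅ N) (hM : IsFinitelyGenerated M) :
    IsFinitelyGenerated N := fun J _ _ F hF =>
  have := hM J F hF
  preservesColimit_of_natIso F (coyoneda.mapIso e.op.symm)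

/-- The cocone with vertex `M` formed by a diagram of subobjects of `M`. -/
@[simps]
def subobjectCocone {M : D} {J : Type w} [Category.{w} J] (T : J ⥤ Subobject M) :
    Cocone (T ⋙ Subobject.underlying) where
  pt := M
  ι := { app := fun j => (T.obj j).arrow }

lemma mono_underlying_map {M : D} {S T : Subobject M} (f : S ⟶ T) :
    Mono (Subobject.underlying.map f) :=
  have : Mono (Subobject.underlying.map f ≫ T.arrow) := by
    rw [Subobject.underlying_arrow]; infer_instance
  mono_of_mono _ T.arrow

variable (D) in
/-- Every object of `D` is the colimit of a small filtered system of finitely generated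
subobjects. -/
def LocallyFinitelyGenerated : Prop :=
  ∀ M : D, ∃ (J : Type v) (_ : SmallCategory J) (_ : IsFiltered J) (T : J ⥤ Subobject M),
    (∀ j, IsFinitelyGenerated (T.obj j : D)) ∧ Nonempty (IsColimit (subobjectCocone T))

/-- The system of all finitely generated subobjects is replaced by a small cofinal one. -/
lemma locallyFinitelyGenerated_of_isDirectedColimit
    (h : ∀ M : D, IsDirectedColimitOfSubobjects.{v} IsFinitelyGenerated M) :
    LocallyFinitelyGenerated D := by
  intro M
  obtain ⟨h₁, h₂, ⟨h₃⟩⟩ := h M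
  obtain ⟨s, _, hs⟩ := FinallySmall.exists_small_weakly_terminal_set.{v}
    (SubobjectsWith IsFinitelyGenerated M)
  have : IsFiltered (ObjectProperty.FullSubcategory (· ∈ s)) :=
    IsFiltered.of_exists_of_isFiltered_of_fullyFaithful (ObjectProperty.ι (· ∈ s)) (fun i => by
      obtain ⟨j, hj₁, hj₂⟩ := hs i
      exact ⟨⟨j, hj₁⟩, hj₂⟩)
  have : (ObjectProperty.ι (· ∈ s)).Final :=
    Functor.final_of_exists_of_isFiltered_of_fullyFaithful _ (fun i => by
      obtain ⟨j, hj₁, hj₂⟩ := hs i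
      exact ⟨⟨j, hj₁⟩, hj₂⟩)
  let e := equivSmallModel.{v} (ObjectProperty.FullSubcategory (· ∈ s))
  let G := e.inverse ⋙ ObjectProperty.ι (· ∈ s)
  have : IsFiltered (SmallModel.{v} (ObjectProperty.FullSubcategory (· ∈ s))) :=
    IsFiltered.of_equivalence e
  have : G.Final := Functor.final_comp _ _
  exact ⟨_, inferInstance, inferInstance, G ⋙ ObjectProperty.ι _, fun j => (G.obj j).property,
    ⟨(Functor.Final.isColimitWhiskerEquiv G _).symm h₃⟩⟩

section AB5

variable [Abelian D] [HasColimits D] [AB5 D]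

lemma mono_ι_of_isColimit {J : Type v} [SmallCategory J] [IsFiltered J] {F : J ⥤ D}
    (hF : ∀ (i j : J) (f : i ⟶ j), Mono (F.map f)) {c : Cocone F} (hc : IsColimit c) (j : J) :
    Mono (c.ι.app j) :=
  hc.mono_ι_app_of_isFiltered j

/-- For finite generation, only the surjectivity of the map from `colim Hom(M, M_i)` to
`Hom(M, colim M_i)` matters: the maps `M_i ⟶ colim M_i` are monomorphisms. -/
lemma isFinitelyGenerated_of_exists_factorization {M : D}
    (h : ∀ (J : Type v) [SmallCategory J] [IsFiltered J] (F : J ⥤ D)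
      (_ : ∀ (i j : J) (f : i ⟶ j), Mono (F.map f)) (c : Cocone F) (_ : IsColimit c)
      (g : M ⟶ c.pt), ∃ (j : J) (h : M ⟶ F.obj j), h ≫ c.ι.app j = g) :
    IsFinitelyGenerated M := by
  intro J _ _ F hF
  refine ⟨fun {c} hc => ⟨Types.FilteredColimit.isColimitOf' _ _ (fun g => ?_) fun i x y hxy => ?_⟩⟩
  · obtain ⟨j, k, hk⟩ := h J F hF c hc g
    exact ⟨j, k, hk.symm⟩
  · have := mono_ι_of_isColimit hF hc i
    exact ⟨i, 𝟙 i, congrArg _ ((cancel_mono (c.ι.app i)).1 hxy)⟩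

/-- A factorization lifts along an epimorphism, which is orthogonal to the monomorphism
`M_j ⟶ colim M_i`. -/
lemma IsFinitelyGenerated.of_epi {M N : D} (e : M ⟶ N) [Epi e] (hM : IsFinitelyGenerated M) :
    IsFinitelyGenerated N :=
  isFinitelyGenerated_of_exists_factorization fun J _ _ F hF c hc g => by
    obtain ⟨j, h, hh⟩ := hM.exists_factorization hF hc (e ≫ g)
    have := mono_ι_of_isColimit hF hc j
    have := strongEpi_of_epi e
    have sq : CommSq h e (c.ι.app j) g := ⟨hh⟩
    exact ⟨j, sq.lift, sq.fac_right⟩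

lemma IsFinitelyGenerated.coprod {M N : D} (hM : IsFinitelyGenerated M)
    (hN : IsFinitelyGenerated N) : IsFinitelyGenerated (M ⨿ N) :=
  isFinitelyGenerated_of_exists_factorization fun J _ _ F hF c hc g => by
    obtain ⟨i, h, hh⟩ := hM.exists_factorization hF hc (coprod.inl ≫ g)
    obtain ⟨j, k, hk⟩ := hN.exists_factorization hF hc (coprod.inr ≫ g)
    refine ⟨IsFiltered.max i j, coprod.desc (h ≫ F.map (IsFiltered.leftToMax i j))
      (k ≫ F.map (IsFiltered.rightToMax i j)), ?_⟩
    ext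
    · simpa [hh] using coprod.inl_desc _ _
    · simpa [hk] using coprod.inr_desc _ _

lemma sup_eq_imageSubobject {M : D} (S T : Subobject M) :
    S ⊔ T = imageSubobject (coprod.desc S.arrow T.arrow) := by
  refine le_antisymm (sup_le ?_ ?_) (imageSubobject_le _
    (coprod.desc (Subobject.ofLE _ _ le_sup_left) (Subobject.ofLE _ _ le_sup_right))
    (by ext <;> simp))
  · exact Subobject.le_of_comm (coprod.inl ≫ factorThruImageSubobject _)
      (by simpa using coprod.inl_desc _ _)
  · exact Subobject.le_of_comm (coprod.inr ≫ factorThruImageSubobject _)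
      (by simpa using coprod.inr_desc _ _)

lemma IsFinitelyGenerated.sup {M : D} {S T : Subobject M} (hS : IsFinitelyGenerated (S : D))
    (hT : IsFinitelyGenerated (T : D)) : IsFinitelyGenerated ((S ⊔ T : Subobject M) : D) := by
  rw [sup_eq_imageSubobject]
  exact (hS.coprod hT).of_epi (factorThruImageSubobject _)

/-- The union of a filtered system of subobjects is a subobject. -/
lemma mono_desc_subobjectCocone {M : D} {J : Type v} [SmallCategory J] [IsFiltered J]
    (T : J ⥤ Subobject M) : Mono (colimit.desc _ (subobjectCocone T)) := by
  let φ : T ⋙ Subobject.underlying ⟶ (Functor.const J).obj M :=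
    { app := fun j => (T.obj j).arrow }
  have (j : J) : Mono (φ.app j) := inferInstanceAs (Mono (T.obj j).arrow)
  have := NatTrans.mono_of_mono_app φ
  have := IsFiltered.isConnected J
  exact colim.map_mono' φ (colimit.isColimit _) (isColimitConstCocone J M) _
    (fun j => (colimit.ι_desc _ _).trans (Category.comp_id _).symm)

/-- A filtered system of subobjects of `M` has colimit `M` as soon as the inclusions are jointly
epimorphic. -/
lemma nonempty_isColimit_subobjectCocone {M : D} {J : Type v} [SmallCategory J] [IsFiltered J]
    (T : J ⥤ Subobject M)
    (hT : ∀ (Z : D) (f g : M ⟶ Z), (∀ j, (T.obj j).arrow ≫ f = (T.obj j).arrow ≫ g) → f = g) :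
    Nonempty (IsColimit (subobjectCocone T)) := by
  have := mono_desc_subobjectCocone T
  have : Epi (colimit.desc _ (subobjectCocone T)) := ⟨fun {Z} f g h => hT Z f g fun j => by
    have := congrArg (colimit.ι (T ⋙ Subobject.underlying) j ≫ ·) h
    simp only [colimit.ι_desc_assoc, subobjectCocone_ι_app] at this
    exact this⟩
  have : IsIso ((colimit.isColimit (T ⋙ Subobject.underlying)).desc (subobjectCocone T)) :=
    isIso_of_mono_of_epi (colimit.desc _ (subobjectCocone T))
  exact ⟨IsColimit.ofPointIso (colimit.isColimit _)⟩

end AB5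

section Adjunction

variable {E : Type w} [Category.{v} E] [Abelian D] [HasColimits D] [AB5 D]
  [Abelian E] [HasColimits E] [AB5 E] {L : E ⥤ D} {R : D ⥤ E}

lemma IsFinitelyGenerated.leftAdjoint_obj (adj : L ⊣ R) [PreservesColimitsOfSize.{v, v} R]
    {M : E} (hM : IsFinitelyGenerated M) : IsFinitelyGenerated (L.obj M) :=
  isFinitelyGenerated_of_exists_factorization fun J _ _ F hF c hc g => by
    have : R.PreservesMonomorphisms := R.preservesMonomorphisms_of_adjunction adj
    obtain ⟨j, h, hh⟩ := hM.exists_factorization (F := F ⋙ R)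
      (fun i j f => have := hF i j f; inferInstanceAs (Mono (R.map (F.map f))))
      (isColimitOfPreserves R hc) (adj.homEquiv _ _ g)
    refine ⟨j, (adj.homEquiv _ _).symm h, ?_⟩
    rw [← Adjunction.homEquiv_naturality_right_symm, Equiv.symm_apply_eq]
    exact hh

/-- If `R` is a faithful right adjoint preserving colimits, then images of the finitely generated
subobjects of `R M` under the counit exhaust `M`. -/
lemma LocallyFinitelyGenerated.of_adjunction (adj : L ⊣ R) [PreservesColimitsOfSize.{v, v} R]
    [R.Faithful] (hE : LocallyFinitelyGenerated E) : LocallyFinitelyGenerated D := by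
  intro M
  obtain ⟨J, _, _, T, hT, ⟨hc⟩⟩ := hE (R.obj M)
  let k (j : J) : L.obj (T.obj j : E) ⟶ M := (adj.homEquiv _ _).symm (T.obj j).arrow
  have hk {i j : J} (f : i ⟶ j) : L.map (Subobject.underlying.map (T.map f)) ≫ k j = k i := by
    rw [← Adjunction.homEquiv_naturality_left_symm, Subobject.underlying_arrow]
  let S : J ⥤ Subobject M :=
    { obj := fun j => imageSubobject (k j)
      map := fun {i j} f => homOfLE (imageSubobject_le _
        (L.map (Subobject.underlying.map (T.map f)) ≫ factorThruImageSubobject (k j))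
        (by rw [Category.assoc, imageSubobject_arrow_comp, hk]))
      map_id := fun _ => Subsingleton.elim _ _
      map_comp := fun _ _ => Subsingleton.elim _ _ }
  refine ⟨J, inferInstance, inferInstance, S, fun j =>
    ((hT j).leftAdjoint_obj adj).of_epi (factorThruImageSubobject (k j)), ?_⟩
  refine nonempty_isColimit_subobjectCocone S fun Z f g h => R.map_injective (hc.hom_ext fun j => ?_)
  have h' : k j ≫ f = k j ≫ g := by
    have := congrArg (factorThruImageSubobject (k j) ≫ ·) (h j)
    simpa only [S, imageSubobject_arrow_comp_assoc] using this
  have h'' := congrArg (adj.homEquiv _ _) h'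
  rwa [Adjunction.homEquiv_naturality_right, Adjunction.homEquiv_naturality_right,
    Equiv.apply_symm_apply] at h''

end Adjunction

end FinitelyGenerated

section FinitelyGeneratedModules

variable {C : Type u} [Category.{v} C] [Abelian C] [HasLimits C] [HasColimits C]
    [MonoidalCategory C] [SymmetricCategory C] [MonoidalClosed C]

instance [AB5 C] (A : C) [MonObj A] : AB5 (Mod C A) where
  ofShape J _ _ := HasExactColimitsOfShape.domain_of_functor J (Mod.forget A)

/-- Free modules: the left adjoint of the forgetful functor. -/
def freeForgetAdj (A : C) [MonObj A] :
    (actionMonad A).free ⋙ ofAlgebra A ⊣ (Mod.forget A : Mod C A ⥤ C) :=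
  (actionMonad A).adj.comp (modEquivAlgebra A).symm.toAdjunction

lemma LocallyFinitelyGenerated.mod [AB5 C] (hC : LocallyFinitelyGenerated C) (A : C) [MonObj A] :
    LocallyFinitelyGenerated (Mod C A) :=
  hC.of_adjunction (freeForgetAdj A)

instance {A B : CommMon C} (f : A ⟶ B) : PreservesColimitsOfSize.{v, v} (restrictScalars f) :=
  have : PreservesColimitsOfSize.{v, v} (restrictScalars f ⋙ Mod.forget A.X) :=
    inferInstanceAs (PreservesColimitsOfSize.{v, v} (Mod.forget B.X))
  preservesColimits_of_reflects_of_preserves _ (Mod.forget A.X)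

lemma IsFinitelyGenerated.extendScalars [AB5 C] {A B : CommMon C} (f : A ⟶ B) {M : ModOver A}
    (hM : IsFinitelyGenerated M) : IsFinitelyGenerated ((extendScalars f).obj M) :=
  hM.leftAdjoint_obj (extendRestrictAdj f)

end FinitelyGeneratedModules

/-! ### Quotients of commutative monoids and tensor products of algebras -/

section TensorProduct

open MonObj ModObj

section CommMonoid

variable {C : Type u} [Category.{v} C] [MonoidalCategory C] [SymmetricCategory C]

instance isMonHom_one (M : C) [MonObj M] : IsMonHom η[M] where
  one_hom := by simp
  mul_hom := by
    change (λ_ (𝟙_ C)).hom ≫ η = _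
    rw [MonoidalCategory.tensorHom_def, Category.assoc, MonObj.mul_one]
    simp [unitors_equal]

instance isMonHom_mul (M : C) [MonObj M] [IsCommMonObj M] : IsMonHom μ[M] where
  one_hom := by rw [MonObj.tensorObj.one_def]; simp [← unitors_equal]
  mul_hom := by
    rw [MonObj.tensorObj.mul_def, Category.assoc]
    exact MonObj.mul_mul_mul_comm M

/-- The first inclusion `b ↦ b ⊗ 1` into a tensor product of monoids. -/
def inclLeft (M N : C) [MonObj N] : M ⟶ M ⊗ N := (ρ_ M).inv ≫ M ◁ η[N]

/-- The second inclusion `c ↦ 1 ⊗ c` into a tensor product of monoids. -/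
def inclRight (M N : C) [MonObj M] : N ⟶ M ⊗ N := (λ_ N).inv ≫ η[M] ▷ N

instance (M N : C) [MonObj M] [MonObj N] : IsMonHom (inclLeft M N) := by
  unfold inclLeft; infer_instance

instance (M N : C) [MonObj M] [MonObj N] : IsMonHom (inclRight M N) := by
  unfold inclRight; infer_instance

/-- Every element of `M ⊗ N` is `(m ⊗ 1) (1 ⊗ n)`. -/
lemma inclLeft_inclRight_mul (M N : C) [MonObj M] [MonObj N] :
    (inclLeft M N ⊗ₘ inclRight M N) ≫ μ[M ⊗ N] = 𝟙 _ := by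
  have h1 : M ◁ η[N] = 𝟙 M ⊗ₘ η[N] := by simp
  have h2 : η[M] ▷ N = η[M] ⊗ₘ 𝟙 N := by simp
  rw [MonObj.tensorObj.mul_def, inclLeft, inclRight, ← tensorHom_comp_tensorHom, Category.assoc,
    h1, h2]
  rw [tensorμ_natural_assoc, tensorHom_comp_tensorHom]
  have h3 : (𝟙 M ⊗ₘ η[M]) ≫ μ = (ρ_ M).hom := by simp
  have h4 : (η[N] ⊗ₘ 𝟙 N) ≫ μ = (λ_ N).hom := by simp
  rw [h3, h4, tensorμ, braiding_tensorUnit_left]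
  monoidal

variable {P : C} [MonObj P]

/-- The symmetry `(X ⊗ Y) ⊗ Z ⟶ (X ⊗ Z) ⊗ Y`. -/
def swapRight (X Y Z : C) : (X ⊗ Y) ⊗ Z ⟶ (X ⊗ Z) ⊗ Y :=
  (α_ X Y Z).hom ≫ X ◁ (β_ Y Z).hom ≫ (α_ X Z Y).inv

lemma swapRight_naturality {X X' Y Y' Z Z' : C} (p : X ⟶ X') (q : Y ⟶ Y') (r : Z ⟶ Z') :
    ((p ⊗ₘ q) ⊗ₘ r) ≫ swapRight X' Y' Z' = swapRight X Y Z ≫ ((p ⊗ₘ r) ⊗ₘ q) := by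
  simp only [swapRight, Category.assoc]
  rw [associator_naturality_assoc, ← associator_inv_naturality, ← id_tensorHom, ← id_tensorHom,
    tensorHom_comp_tensorHom_assoc, tensorHom_comp_tensorHom_assoc,
    BraidedCategory.braiding_naturality, Category.id_comp, Category.comp_id]

lemma tensorHom_mul_mul {X Y Z : C} (p : X ⟶ P) (q : Y ⟶ P) (r : Z ⟶ P) :
    ((p ⊗ₘ q) ≫ μ ⊗ₘ r) ≫ μ = ((p ⊗ₘ q) ⊗ₘ r) ≫ μ ▷ P ≫ μ := by
  rw [← tensorHom_id, tensorHom_comp_tensorHom_assoc, Category.comp_id]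

lemma tensorHom_mul_assoc {X Y Z : C} (p : X ⟶ P) (q : Y ⟶ P) (r : Z ⟶ P) :
    ((p ⊗ₘ q) ≫ μ ⊗ₘ r) ≫ μ = (α_ X Y Z).hom ≫ (p ⊗ₘ (q ⊗ₘ r) ≫ μ) ≫ μ := by
  rw [tensorHom_mul_mul, MonObj.mul_assoc, associator_naturality_assoc, ← id_tensorHom,
    tensorHom_comp_tensorHom_assoc, Category.comp_id]

/-- In a commutative monoid, `(p q) r = (p r) q`. -/
lemma tensorHom_mul_right_comm [IsCommMonObj P] {X Y Z : C} (p : X ⟶ P) (q : Y ⟶ P) (r : Z ⟶ P) :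
    ((p ⊗ₘ q) ≫ μ ⊗ₘ r) ≫ μ = swapRight X Y Z ≫ ((p ⊗ₘ r) ≫ μ ⊗ₘ q) ≫ μ := by
  have h : swapRight P P P ≫ μ[P] ▷ P ≫ μ = μ ▷ P ≫ μ := by
    simp only [swapRight, Category.assoc, MonObj.mul_assoc, Iso.inv_hom_id_assoc]
    rw [← MonoidalCategory.whiskerLeft_comp_assoc, IsCommMonObj.mul_comm]
  rw [tensorHom_mul_mul, tensorHom_mul_mul, ← Category.assoc (swapRight X Y Z),
    ← swapRight_naturality, Category.assoc, h]

section Quotient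

variable [MonoidalClosed C] [HasColimits C]

instance epi_whiskerLeft {X Y : C} (Z : C) (f : X ⟶ Y) [Epi f] : Epi (Z ◁ f) :=
  inferInstanceAs (Epi ((tensorLeft Z).map f))

instance epi_whiskerRight {X Y : C} (f : X ⟶ Y) [Epi f] (Z : C) : Epi (f ▷ Z) :=
  inferInstanceAs (Epi ((tensorRight Z).map f))

instance epi_tensorHom {X Y X' Y' : C} (f : X ⟶ Y) [Epi f] (g : X' ⟶ Y') [Epi g] :
    Epi (f ⊗ₘ g) := by
  rw [MonoidalCategory.tensorHom_def]; infer_instance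

variable {Q : C} {π : P ⟶ Q}

/-- The multiplication of a commutative monoid `P` descends to the coequalizer `Q` of a pair of
morphisms `r, s` such that `p r(z) = p s(z)` in `Q`. -/
lemma exists_quotient_mul [IsCommMonObj P] {Z : C} {r s : Z ⟶ P} (w : r ≫ π = s ≫ π)
    (hc : IsColimit (Cofork.ofπ π w)) (h : P ◁ r ≫ μ ≫ π = P ◁ s ≫ μ ≫ π) :
    ∃ m : Q ⊗ Q ⟶ Q, (π ⊗ₘ π) ≫ m = μ ≫ π := by
  have : Epi π := Cofork.IsColimit.epi hc
  obtain ⟨a, ha⟩ := Cofork.IsColimit.desc' (isColimitCoforkMapOfIsColimit (tensorLeft P) w hc)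
    (μ ≫ π) h
  replace ha : P ◁ π ≫ a = μ ≫ π := ha
  have hr (x : Z ⟶ P) : Z ◁ π ≫ x ▷ Q ≫ a = (β_ Z P).hom ≫ P ◁ x ≫ μ ≫ π := by
    rw [whisker_exchange_assoc, ha, ← BraidedCategory.braiding_naturality_left_assoc,
      IsCommMonObj.mul_comm_assoc]
  have hrs : r ▷ Q ≫ a = s ▷ Q ≫ a := by
    rw [← cancel_epi (Z ◁ π), hr, hr, h]
  obtain ⟨m, hm⟩ := Cofork.IsColimit.desc' (isColimitCoforkMapOfIsColimit (tensorRight Q) w hc)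
    a hrs
  replace hm : π ▷ Q ≫ m = a := hm
  exact ⟨m, by rw [MonoidalCategory.tensorHom_def', Category.assoc, hm, ha]⟩

/-- The monoid structure on a quotient `π : P ⟶ Q` of a monoid `P`, given that the
multiplication descends to `Q`. -/
@[reducible]
def quotientMonObj [Epi π] (m : Q ⊗ Q ⟶ Q) (hm : (π ⊗ₘ π) ≫ m = μ ≫ π) : MonObj Q where
  one := MonObj.one ≫ π
  mul := m
  one_mul := by
    rw [← cancel_epi (𝟙_ C ◁ π), whisker_exchange_assoc, comp_whiskerRight, Category.assoc,
      ← whisker_exchange_assoc, ← MonoidalCategory.tensorHom_def'_assoc, hm, MonObj.one_mul_assoc]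
    simp
  mul_one := by
    rw [← cancel_epi (π ▷ 𝟙_ C), ← whisker_exchange_assoc, MonoidalCategory.whiskerLeft_comp,
      Category.assoc, whisker_exchange_assoc, ← MonoidalCategory.tensorHom_def_assoc, hm,
      MonObj.mul_one_assoc]
    simp
  mul_assoc := by
    rw [← cancel_epi ((π ⊗ₘ π) ⊗ₘ π), associator_naturality_assoc, ← tensorHom_id,
      tensorHom_comp_tensorHom_assoc, hm, ← id_tensorHom, tensorHom_comp_tensorHom_assoc, hm,
      Category.comp_id, ← Category.id_comp π, ← tensorHom_comp_tensorHom_assoc,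
      ← tensorHom_comp_tensorHom_assoc, Category.id_comp, hm, tensorHom_id, id_tensorHom,
      MonObj.mul_assoc_assoc]

lemma quotientMonObj_comm [Epi π] [IsCommMonObj P] (m : Q ⊗ Q ⟶ Q)
    (hm : (π ⊗ₘ π) ≫ m = μ ≫ π) :
    letI := quotientMonObj m hm
    IsCommMonObj Q :=
  letI := quotientMonObj m hm
  { mul_comm := by
      change (β_ Q Q).hom ≫ m = m
      rw [← cancel_epi (π ⊗ₘ π), BraidedCategory.braiding_naturality_assoc, hm,
        IsCommMonObj.mul_comm_assoc] }

lemma quotientMonObj_isMonHom [Epi π] (m : Q ⊗ Q ⟶ Q) (hm : (π ⊗ₘ π) ≫ m = μ ≫ π) :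
    letI := quotientMonObj m hm
    IsMonHom π :=
  letI := quotientMonObj m hm
  { one_hom := rfl
    mul_hom := hm.symm }

end Quotient

end CommMonoid

section Algebras

variable {C : Type u} [Category.{v} C] [MonoidalCategory C] [SymmetricCategory C]
variable [MonoidalClosed C] [HasColimits C]
variable {A B E D : CommMon C} (f : A ⟶ B) (g : A ⟶ E)

/-- `E` as a module over `A`, along `g : A ⟶ E`. -/
abbrev algebraModule : ModOver A := (restrictScalars g).obj (Mod.regular E.X)

/-- The object `B ⊗_A E` underlying the tensor product of algebras. -/
def tensorX : C := extX f (algebraModule g)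

/-- The projection `B ⊗ E ⟶ B ⊗_A E`. -/
def tensorπ : B.X ⊗ E.X ⟶ tensorX f g := extπ f (algebraModule g)

/-- The morphism `(b ⊗ a) ⊗ e ↦ b f(a) ⊗ e`. -/
def tensorRelLeft : (B.X ⊗ A.X) ⊗ E.X ⟶ B.X ⊗ E.X := (B.X ◁ homX f ≫ μ) ▷ E.X

/-- The morphism `(b ⊗ a) ⊗ e ↦ b ⊗ g(a) e`. -/
def tensorRelRight (B : CommMon C) (g : A ⟶ E) : (B.X ⊗ A.X) ⊗ E.X ⟶ B.X ⊗ E.X :=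
  (α_ B.X A.X E.X).hom ≫ B.X ◁ (homX g ▷ E.X ≫ μ)

lemma tensorπ_condition :
    tensorRelLeft (E := E) f ≫ tensorπ f g = tensorRelRight B g ≫ tensorπ f g :=
  extπ_condition f (algebraModule g)

/-- `B ⊗_A E` is a coequalizer. -/
def tensorIsColimit : IsColimit (Cofork.ofπ (tensorπ f g) (tensorπ_condition f g)) :=
  coequalizerIsCoequalizer (extLeft f (algebraModule g)) (extRight f (algebraModule g))

instance : Epi (tensorπ f g) := inferInstanceAs (Epi (extπ f (algebraModule g)))

/-- The morphism `B ⊗ E ⟶ D`, `b ⊗ e ↦ i(b) j(e)`. -/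
def mulMap (i : B ⟶ D) (j : E ⟶ D) : B.X ⊗ E.X ⟶ D.X := (homX i ⊗ₘ homX j) ≫ μ

lemma homX_comp {A₁ A₂ A₃ : CommMon C} (k : A₁ ⟶ A₂) (l : A₂ ⟶ A₃) :
    homX (k ≫ l) = homX k ≫ homX l := rfl

lemma mulMap_comp {D' : CommMon C} (i : B ⟶ D) (j : E ⟶ D) (k : D ⟶ D') :
    mulMap i j ≫ homX k = mulMap (i ≫ k) (j ≫ k) := by
  rw [mulMap, mulMap, homX_comp, homX_comp, Category.assoc, IsMonHom.mul_hom,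
    tensorHom_comp_tensorHom_assoc]

instance (i : B ⟶ D) (j : E ⟶ D) : IsMonHom (mulMap i j) :=
  inferInstanceAs (IsMonHom ((homX i ⊗ₘ homX j) ≫ μ[D.X]))

lemma inclLeft_mulMap (i : B ⟶ D) (j : E ⟶ D) : inclLeft B.X E.X ≫ mulMap i j = homX i := by
  rw [inclLeft, mulMap, ← id_tensorHom, Category.assoc, tensorHom_comp_tensorHom_assoc,
    IsMonHom.one_hom, Category.id_comp, MonoidalCategory.tensorHom_def, Category.assoc,
    MonObj.mul_one]
  simp

lemma inclRight_mulMap (i : B ⟶ D) (j : E ⟶ D) : inclRight B.X E.X ≫ mulMap i j = homX j := by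
  rw [inclRight, mulMap, ← tensorHom_id, Category.assoc, tensorHom_comp_tensorHom_assoc,
    IsMonHom.one_hom, Category.id_comp, MonoidalCategory.tensorHom_def', Category.assoc,
    MonObj.one_mul]
  simp

lemma tensorRelLeft_mulMap (i : B ⟶ D) (j : E ⟶ D) :
    tensorRelLeft f ≫ mulMap i j = ((homX i ⊗ₘ homX (f ≫ i)) ≫ μ ⊗ₘ homX j) ≫ μ := by
  rw [tensorRelLeft, mulMap, ← tensorHom_id, tensorHom_comp_tensorHom_assoc, Category.assoc,
    IsMonHom.mul_hom, ← id_tensorHom, tensorHom_comp_tensorHom_assoc, homX_comp]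
  simp only [Category.id_comp]

lemma tensorRelRight_mulMap (i : B ⟶ D) (j : E ⟶ D) :
    tensorRelRight B g ≫ mulMap i j = ((homX i ⊗ₘ homX (g ≫ j)) ≫ μ ⊗ₘ homX j) ≫ μ := by
  rw [tensorRelRight, tensorHom_mul_assoc, mulMap, Category.assoc, ← id_tensorHom,
    tensorHom_comp_tensorHom_assoc, Category.assoc, IsMonHom.mul_hom, ← tensorHom_id,
    tensorHom_comp_tensorHom_assoc, homX_comp]
  simp only [Category.id_comp]

lemma mulMap_condition (i : B ⟶ D) (j : E ⟶ D) (w : f ≫ i = g ≫ j) :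
    tensorRelLeft f ≫ mulMap i j = tensorRelRight B g ≫ mulMap i j := by
  rw [tensorRelLeft_mulMap, tensorRelRight_mulMap, w]

/-- For a commutative square of commutative monoids, the morphism `B ⊗_A E ⟶ D`. -/
def tensorDesc (i : B ⟶ D) (j : E ⟶ D) (w : f ≫ i = g ≫ j) : tensorX f g ⟶ D.X :=
  extDesc f (algebraModule g) (mulMap i j) (mulMap_condition f g i j w)

lemma tensorπ_tensorDesc (i : B ⟶ D) (j : E ⟶ D) (w : f ≫ i = g ≫ j) :
    tensorπ f g ≫ tensorDesc f g i j w = mulMap i j :=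
  extπ_desc _ _ _ _

/-- A square of commutative monoids exhibiting `D` as the tensor product `B ⊗_A E`. -/
structure IsTensorSquare (i : B ⟶ D) (j : E ⟶ D) : Prop where
  w : f ≫ i = g ≫ j
  isIso : IsIso (tensorDesc f g i j w)

/-- The tensor product `B ⊗_A E` of commutative algebras: its multiplication is induced by that of
`B ⊗ E`. -/
lemma exists_isTensorSquare :
    ∃ (D : CommMon C) (i : B ⟶ D) (j : E ⟶ D), IsTensorSquare f g i j := by
  let P : CommMon C := ⟨B.X ⊗ E.X⟩
  let iP : B ⟶ P := CommMon.homMk (Mon.ofHom (inclLeft B.X E.X))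
  let jP : E ⟶ P := CommMon.homMk (Mon.ofHom (inclRight B.X E.X))
  have hP : mulMap iP jP = 𝟙 _ := inclLeft_inclRight_mul B.X E.X
  have hl : tensorRelLeft f = ((homX iP ⊗ₘ homX (f ≫ iP)) ≫ μ ⊗ₘ homX jP) ≫ μ := by
    rw [← tensorRelLeft_mulMap, hP]
    exact (Category.comp_id _).symm
  have hr : tensorRelRight B g = ((homX iP ⊗ₘ homX (g ≫ jP)) ≫ μ ⊗ₘ homX jP) ≫ μ := by
    rw [← tensorRelRight_mulMap, hP]
    exact (Category.comp_id _).symm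
  let π : P.X ⟶ tensorX f g := tensorπ f g
  have hc : tensorRelLeft f ≫ π = tensorRelRight B g ≫ π := tensorπ_condition f g
  -- both sides of the defining relation are multiples of `f(a) ⊗ 1` and of `1 ⊗ g(a)`
  have key (x : A ⟶ P) : P.X ◁ homX x ≫ μ[P.X] = swapRight B.X E.X A.X ≫
      ((homX iP ⊗ₘ homX x) ≫ μ ⊗ₘ homX jP) ≫ μ := by
    have : P.X ◁ homX x ≫ μ[P.X] = ((homX iP ⊗ₘ homX jP) ≫ μ ⊗ₘ homX x) ≫ μ := by
      rw [← id_tensorHom]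
      exact congrArg (fun t => (t ⊗ₘ homX x) ≫ μ[P.X]) hP.symm
    rw [this, tensorHom_mul_right_comm]
  have key' (x : A ⟶ P) : P.X ◁ (((homX iP ⊗ₘ homX x) ≫ μ ⊗ₘ homX jP) ≫ μ) ≫ μ[P.X] =
      (P.X ◁ swapRight B.X A.X E.X ≫ (α_ _ _ _).inv ≫
        (P.X ◁ ((homX iP ⊗ₘ homX jP) ≫ μ) ≫ μ) ▷ A.X) ≫ P.X ◁ homX x ≫ μ := by
    have := tensorHom_mul_assoc (𝟙 P.X) ((homX iP ⊗ₘ homX jP) ≫ μ) (homX x)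
    rw [← Iso.inv_comp_eq, id_tensorHom, id_tensorHom] at this
    rw [tensorHom_mul_right_comm, MonoidalCategory.whiskerLeft_comp, Category.assoc, ← this]
    simp only [Category.assoc, MonoidalCategory.tensorHom_def]
  have hx : P.X ◁ homX (f ≫ iP) ≫ μ ≫ π = P.X ◁ homX (g ≫ jP) ≫ μ ≫ π := by
    have e1 := congrArg (· ≫ π) (key (f ≫ iP))
    have e2 := congrArg (· ≫ π) (key (g ≫ jP))
    have hc' := hc
    rw [hl, hr, Category.assoc, Category.assoc] at hc'
    simp only [Category.assoc] at e1 e2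
    rw [e1, e2, hc']
  have h : P.X ◁ tensorRelLeft f ≫ μ ≫ π = P.X ◁ tensorRelRight B g ≫ μ ≫ π := by
    have e1 := congrArg (· ≫ π) (key' (f ≫ iP))
    have e2 := congrArg (· ≫ π) (key' (g ≫ jP))
    rw [← hl] at e1
    rw [← hr] at e2
    simp only [Category.assoc, hx] at e1 e2
    exact e1.trans e2.symm
  obtain ⟨m, hm⟩ := exists_quotient_mul (P := P.X) hc (tensorIsColimit f g) h
  have : Epi π := inferInstanceAs (Epi (tensorπ f g))
  let _ := quotientMonObj m hm
  have := quotientMonObj_comm m hm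
  have := quotientMonObj_isMonHom m hm
  let D : CommMon C := ⟨tensorX f g⟩
  let p : P ⟶ D := CommMon.homMk (Mon.ofHom π)
  have hp : mulMap (iP ≫ p) (jP ≫ p) = π := by
    rw [← mulMap_comp, hP]
    exact Category.id_comp _
  have w : f ≫ iP ≫ p = g ≫ jP ≫ p := by
    ext
    have e (x : A ⟶ P) : (λ_ A.X).inv ≫ η ▷ A.X ≫ P.X ◁ homX x ≫ μ ≫ π = homX x ≫ π := by
      rw [← whisker_exchange_assoc, MonObj.one_mul_assoc]
      simp
    have := congrArg (fun t => (λ_ A.X).inv ≫ η ▷ A.X ≫ t) hx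
    simp only [e] at this
    exact (Category.assoc _ _ _).symm.trans (this.trans (Category.assoc _ _ _))
  refine ⟨D, iP ≫ p, jP ≫ p, w, ?_⟩
  have : tensorDesc f g (iP ≫ p) (jP ≫ p) w = 𝟙 _ := by
    rw [← cancel_epi (tensorπ f g), tensorπ_tensorDesc, hp]
    exact (Category.comp_id _).symm
  rw [this]
  infer_instance

variable {f g}

lemma IsTensorSquare.epi_mulMap {i : B ⟶ D} {j : E ⟶ D} (h : IsTensorSquare f g i j) :
    Epi (mulMap i j) := by
  have := h.isIso
  rw [← tensorπ_tensorDesc f g i j h.w]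
  infer_instance

lemma mulMap_inv_tensorDesc {i : B ⟶ D} {j : E ⟶ D} (w : f ≫ i = g ≫ j)
    [IsIso (tensorDesc f g i j w)] :
    mulMap i j ≫ inv (tensorDesc f g i j w) = tensorπ f g := by
  rw [IsIso.comp_inv_eq, tensorπ_tensorDesc]

/-- Pushout squares of commutative monoids are tensor products. -/
lemma IsTensorSquare.of_isPushout {i : B ⟶ D} {j : E ⟶ D} (h : IsPushout f g i j) :
    IsTensorSquare f g i j := by
  obtain ⟨D', i', j', h'⟩ := exists_isTensorSquare f g
  have := h'.isIso
  have := h'.epi_mulMap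
  let e : D ⟶ D' := h.desc i' j' h'.w
  let t : D'.X ⟶ D.X := inv (tensorDesc f g i' j' h'.w) ≫ tensorDesc f g i j h.w
  have ht : mulMap i' j' ≫ t = mulMap i j := by
    rw [← Category.assoc, mulMap_inv_tensorDesc, tensorπ_tensorDesc]
  have : IsMonHom t :=
    { one_hom := by
        rw [← IsMonHom.one_hom (mulMap i' j'), Category.assoc, ht, IsMonHom.one_hom]
      mul_hom := by
        rw [← cancel_epi (mulMap i' j' ⊗ₘ mulMap i' j'), tensorHom_comp_tensorHom_assoc, ht,
          ← IsMonHom.mul_hom_assoc, ht, IsMonHom.mul_hom] }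
  let t' : D' ⟶ D := CommMon.homMk (Mon.ofHom t)
  have hi : i' ≫ t' = i := by
    ext
    change homX i' ≫ t = homX i
    rw [← inclLeft_mulMap i' j', Category.assoc, ht, inclLeft_mulMap]
  have hj : j' ≫ t' = j := by
    ext
    change homX j' ≫ t = homX j
    rw [← inclRight_mulMap i' j', Category.assoc, ht, inclRight_mulMap]
  have h1 : t ≫ homX e = 𝟙 _ := by
    rw [← cancel_epi (mulMap i' j'), ← Category.assoc, ht, mulMap_comp, h.inl_desc, h.inr_desc,
      Category.comp_id]
  have h2 : homX e ≫ t = 𝟙 _ := by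
    have : e ≫ t' = 𝟙 D := h.hom_ext (by simp [e, hi]) (by simp [e, hj])
    exact congrArg homX this
  have : IsIso t := ⟨homX e, h1, h2⟩
  refine ⟨h.w, ?_⟩
  have : tensorDesc f g i j h.w = tensorDesc f g i' j' h'.w ≫ t := by simp [t]
  rw [this]
  infer_instance

/-! ### Base change -/

section BaseChange

variable (f) (M : ModOver A)

lemma extendRestrictAdj_homEquiv (N : ModOver B) :
    (extendRestrictAdj f).homEquiv M N = extHomEquiv f M N := by
  exact congrFun (congrFun (Adjunction.mkOfHomEquiv_homEquiv (F := extendScalars f) _) M) N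

/-- The linear map `B ⊗_A M ⟶ N` given by a linear map `h : M ⟶ N`. -/
abbrev extLift {N : ModOver B} (h : M ⟶ (restrictScalars f).obj N) : (extendScalars f).obj M ⟶ N :=
  ((extendRestrictAdj f).homEquiv M N).symm h

/-- The underlying morphism of `extLift`. -/
def extLiftX {N : ModOver B} (h : M ⟶ (restrictScalars f).obj N) : extX f M ⟶ N.X :=
  (extLift f M h).hom

lemma extUnit_extLiftX {N : ModOver B} (h : M ⟶ (restrictScalars f).obj N) :
    extUnit f M ≫ extLiftX f M h = h.hom := by
  unfold extLiftX extLift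
  rw [extendRestrictAdj_homEquiv]
  exact extUnit_extDesc f M N h.hom _

lemma extπ_extLiftX {N : ModOver B} (h : M ⟶ (restrictScalars f).obj N) :
    extπ f M ≫ extLiftX f M h = B.X ◁ (show M.X ⟶ N.X from h.hom) ≫ γ[B.X, N.X] := by
  unfold extLiftX extLift
  rw [extendRestrictAdj_homEquiv]
  exact extπ_desc _ _ _ _

/-- The underlying morphism of `B ⊗_A φ`. -/
def extMapX {M N : ModOver A} (φ : M ⟶ N) : extX f M ⟶ extX f N :=
  ((extendScalars f).map φ).hom

lemma extUnit_naturality {M N : ModOver A} (φ : M ⟶ N) :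
    extUnit f M ≫ extMapX f φ = φ.hom ≫ extUnit f N := by
  have h : (extendScalars f).map φ = extLift f M (φ ≫ (extendRestrictAdj f).homEquiv N _ (𝟙 _)) := by
    rw [extLift, Adjunction.homEquiv_naturality_left_symm, Equiv.symm_apply_apply, Category.comp_id]
  have h2 : extMapX f φ = extLiftX f M (φ ≫ (extendRestrictAdj f).homEquiv N _ (𝟙 _)) :=
    congrArg Mod.Hom.hom h
  rw [h2]
  refine (extUnit_extLiftX f M _).trans ?_
  rw [extendRestrictAdj_homEquiv]
  exact congrArg (φ.hom ≫ ·) (Category.comp_id (extUnit f N))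

/-- A `B`-linear map out of `B ⊗_A M` is determined by its composition with `M ⟶ B ⊗_A M`. -/
lemma extObj_hom_ext {N : ModOver B} {φ ψ : (extendScalars f).obj M ⟶ N}
    (h : extUnit f M ≫ (show extX f M ⟶ N.X from φ.hom) = extUnit f M ≫ ψ.hom) : φ = ψ := by
  apply ((extendRestrictAdj f).homEquiv M N).injective
  rw [extendRestrictAdj_homEquiv]
  exact Mod.hom_ext _ _ h

variable {f} {g : A ⟶ E} {i : B ⟶ D} {j : E ⟶ D} (K : ModOver E)

/-- The unit `K ⟶ D ⊗_E K`, as a morphism of `A`-modules. -/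
def baseChangeUnit (w : f ≫ i = g ≫ j) : (restrictScalars g).obj K ⟶
    (restrictScalars f).obj ((restrictScalars i).obj ((extendScalars j).obj K)) :=
  Mod.Hom.mk' (M := (restrictScalars g).obj K)
    (N := (restrictScalars f).obj ((restrictScalars i).obj ((extendScalars j).obj K)))
    (show K.X ⟶ extX j K from extUnit j K) (by
      have e : homX f ≫ homX i = homX g ≫ homX j := congrArg homX w
      change (homX g ▷ K.X ≫ γ[E.X, K.X]) ≫ extUnit j K =
        A.X ◁ extUnit j K ≫ homX f ▷ extX j K ≫ homX i ▷ extX j K ≫ extSmul j K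
      rw [← comp_whiskerRight_assoc, e, whisker_exchange_assoc, whiskerLeft_extUnit_extSmul,
        Category.assoc, smul_extUnit, comp_whiskerRight_assoc])

/-- The base change morphism `B ⊗_A K ⟶ D ⊗_E K`, for a commutative square of monoids. -/
def baseChange (w : f ≫ i = g ≫ j) : (extendScalars f).obj ((restrictScalars g).obj K) ⟶
    (restrictScalars i).obj ((extendScalars j).obj K) :=
  extLift f _ (baseChangeUnit K w)

/-- The morphism underlying `baseChange`. -/
def baseChangeX (w : f ≫ i = g ≫ j) : extX f ((restrictScalars g).obj K) ⟶ extX j K :=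
  (baseChange K w).hom

lemma extUnit_baseChangeX (w : f ≫ i = g ≫ j) :
    extUnit f ((restrictScalars g).obj K) ≫ baseChangeX K w = extUnit j K :=
  extUnit_extLiftX f _ (baseChangeUnit K w)

lemma extπ_baseChangeX (w : f ≫ i = g ≫ j) :
    (show B.X ⊗ K.X ⟶ _ from extπ f ((restrictScalars g).obj K)) ≫ baseChangeX K w =
      homX i ▷ K.X ≫ extπ j K := by
  refine (extπ_extLiftX f _ (baseChangeUnit K w)).trans ?_
  change B.X ◁ extUnit j K ≫ homX i ▷ extX j K ≫ extSmul j K = _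
  rw [whisker_exchange_assoc, whiskerLeft_extUnit_extSmul]

lemma baseChange_naturality (w : f ≫ i = g ≫ j) {K K' : ModOver E} (φ : K ⟶ K') :
    (extendScalars f).map ((restrictScalars g).map φ) ≫ baseChange K' w =
      baseChange K w ≫ (restrictScalars i).map ((extendScalars j).map φ) := by
  refine extObj_hom_ext f _ ?_
  change extUnit f ((restrictScalars g).obj K) ≫ extMapX f ((restrictScalars g).map φ) ≫
    baseChangeX K' w = extUnit f ((restrictScalars g).obj K) ≫ baseChangeX K w ≫ extMapX j φ
  rw [reassoc_of% (extUnit_naturality f ((restrictScalars g).map φ)), extUnit_baseChangeX,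
    ← Category.assoc, extUnit_baseChangeX]
  exact (extUnit_naturality j φ).symm

variable (f g) in
/-- The projection `B ⊗ K ⟶ B ⊗_A K`, for an `E`-module `K`. -/
def restrictπ : B.X ⊗ K.X ⟶ extX f ((restrictScalars g).obj K) :=
  extπ f ((restrictScalars g).obj K)

instance : Epi (restrictπ f g K) := inferInstanceAs (Epi (extπ f ((restrictScalars g).obj K)))

variable (f g) in
lemma restrictπ_condition : (B.X ◁ homX f ≫ μ) ▷ K.X ≫ restrictπ f g K =
    (α_ B.X A.X K.X).hom ≫ B.X ◁ (homX g ▷ K.X ≫ γ[E.X, K.X]) ≫ restrictπ f g K :=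
  (extπ_condition f ((restrictScalars g).obj K)).trans (Category.assoc _ _ _)

lemma whiskerLeft_mul_mulMap :
    mulMap i j ▷ E.X ≫ D.X ◁ homX j ≫ μ = (α_ B.X E.X E.X).hom ≫ B.X ◁ μ ≫ mulMap i j := by
  have := tensorHom_mul_assoc (homX i) (homX j) (homX j)
  rw [← IsMonHom.mul_hom (homX j)] at this
  rw [← MonoidalCategory.tensorHom_def_assoc, mulMap, this, ← id_tensorHom,
    tensorHom_comp_tensorHom_assoc, Category.id_comp]

/-- The morphism `(b ⊗ e) ⊗ k ↦ b ⊗ e k`. -/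
def restrictAct (f : A ⟶ B) (g : A ⟶ E) (K : ModOver E) :
    (B.X ⊗ E.X) ⊗ K.X ⟶ extX f ((restrictScalars g).obj K) :=
  (α_ _ _ _).hom ≫ B.X ◁ γ[E.X, K.X] ≫ restrictπ f g K

variable (f g) in
lemma restrictAct_condition :
    tensorRelLeft f ▷ K.X ≫ restrictAct f g K = tensorRelRight B g ▷ K.X ≫ restrictAct f g K := by
  have hc := restrictπ_condition f g K
  have h1 : (homX g ▷ E.X ≫ μ) ▷ K.X ≫ γ[E.X, K.X] =
      (α_ _ _ _).hom ≫ A.X ◁ γ[E.X, K.X] ≫ homX g ▷ K.X ≫ γ[E.X, K.X] := by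
    rw [whisker_exchange_assoc, comp_whiskerRight, Category.assoc, ModObj.mul_smul_self]
    simp
  have h2 := congrArg (B.X ◁ ·) h1
  simp only [MonoidalCategory.whiskerLeft_comp] at h2
  calc _ = (α_ _ _ _).hom ≫ (B.X ⊗ A.X) ◁ γ[E.X, K.X] ≫
        (B.X ◁ homX f ≫ μ) ▷ K.X ≫ restrictπ f g K := by
          rw [whisker_exchange_assoc, tensorRelLeft, restrictAct, associator_naturality_left_assoc]
    _ = _ := by
      rw [hc, tensorRelRight, restrictAct]
      simp only [MonoidalCategory.whiskerLeft_comp, comp_whiskerRight, Category.assoc,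
        whisker_assoc, Iso.inv_hom_id_assoc] at h2 ⊢
      rw [reassoc_of% h2]
      simp

/-- For a tensor product `D = B ⊗_A E` and an `E`-module `K`, `B ⊗_A K = D ⊗_E K`. -/
lemma IsTensorSquare.isIso_baseChange (h : IsTensorSquare f g i j) :
    IsIso (baseChange K h.w) := by
  have := h.isIso
  have hepi := h.epi_mulMap
  obtain ⟨ψ₀, hψ₀⟩ := Cofork.IsColimit.desc' (isColimitCoforkMapOfIsColimit (tensorRight K.X) _
    (tensorIsColimit f g)) (restrictAct f g K) (restrictAct_condition f g K)
  replace hψ₀ : tensorπ f g ▷ K.X ≫ ψ₀ = restrictAct f g K := hψ₀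
  obtain ⟨ψ₁, hψ₁⟩ : ∃ ψ₁, mulMap i j ▷ K.X ≫ ψ₁ = restrictAct f g K :=
    ⟨inv (tensorDesc f g i j h.w) ▷ K.X ≫ ψ₀, by
      rw [← comp_whiskerRight_assoc, mulMap_inv_tensorDesc, hψ₀]⟩
  have hc : extLeft j K ≫ ψ₁ = extRight j K ≫ ψ₁ := by
    rw [← cancel_epi (mulMap i j ▷ E.X ▷ K.X), extLeft, ← comp_whiskerRight_assoc,
      whiskerLeft_mul_mulMap, extRight, Category.assoc, associator_naturality_left_assoc,
      ← whisker_exchange_assoc, hψ₁, comp_whiskerRight_assoc, comp_whiskerRight_assoc, hψ₁,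
      restrictAct]
    have h2 := congrArg (B.X ◁ ·) (ModObj.mul_smul_self E.X K.X)
    simp only [MonoidalCategory.whiskerLeft_comp, Category.assoc, whisker_assoc,
      Iso.inv_hom_id_assoc] at h2 ⊢
    rw [reassoc_of% h2]
    simp
  let ψ : extX j K ⟶ extX f ((restrictScalars g).obj K) := extDesc j K ψ₁ hc
  have hψ : extπ j K ≫ ψ = ψ₁ := extπ_desc _ _ _ _
  have e0 : restrictπ f g K ≫ baseChangeX K h.w = homX i ▷ K.X ≫ extπ j K := extπ_baseChangeX K h.w
  have e1 : baseChangeX K h.w ≫ ψ = 𝟙 _ := by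
    rw [← cancel_epi (restrictπ f g K), reassoc_of% e0, hψ, ← inclLeft_mulMap i j,
      comp_whiskerRight_assoc, hψ₁, restrictAct, inclLeft, comp_whiskerRight_assoc,
      associator_naturality_middle_assoc, ← MonoidalCategory.whiskerLeft_comp_assoc,
      ModObj.one_smul_self]
    simp
  have e2 : ψ ≫ baseChangeX K h.w = 𝟙 _ := by
    rw [← cancel_epi (extπ j K), reassoc_of% hψ, ← cancel_epi (mulMap i j ▷ K.X),
      reassoc_of% hψ₁, restrictAct, Category.assoc, Category.assoc, e0, whisker_exchange_assoc,
      Category.comp_id, mulMap, MonoidalCategory.tensorHom_def, Category.assoc,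
      comp_whiskerRight_assoc]
    have hc' : (D.X ◁ homX j ≫ μ) ▷ K.X ≫ extπ j K =
      (α_ D.X E.X K.X).hom ≫ D.X ◁ γ[E.X, K.X] ≫ extπ j K :=
        (extπ_condition j K).trans (Category.assoc _ _ _)
    rw [hc', associator_naturality_left_assoc]
  have : IsIso ((Mod.forget B.X).map (baseChange K h.w)) := ⟨ψ, e1, e2⟩
  exact isIso_of_reflects_iso _ (Mod.forget B.X)

end BaseChange

end Algebras

end TensorProduct

/-! ### Conservative families and the Zariski topology -/

section ScalarsComp

open MonObj ModObj

variable {C : Type u} [Category.{v} C] [MonoidalCategory C] [SymmetricCategory C]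
variable [MonoidalClosed C] [HasColimits C] {A B E D : CommMon C}

/-- Restriction of scalars along a composition. -/
def restrictScalarsComp (f : A ⟶ B) (g : B ⟶ E) :
    restrictScalars g ⋙ restrictScalars f ≅ restrictScalars (f ≫ g) :=
  NatIso.ofComponents
    (fun M =>
      { hom := Mod.Hom.mk' (M := (restrictScalars g ⋙ restrictScalars f).obj M)
          (N := (restrictScalars (f ≫ g)).obj M) (𝟙 M.X) (by
            change (homX f ▷ M.X ≫ homX g ▷ M.X ≫ γ[E.X, M.X]) ≫ 𝟙 M.X =
              A.X ◁ 𝟙 M.X ≫ (homX f ≫ homX g) ▷ M.X ≫ γ[E.X, M.X]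
            simp)
        inv := Mod.Hom.mk' (N := (restrictScalars g ⋙ restrictScalars f).obj M)
          (M := (restrictScalars (f ≫ g)).obj M) (𝟙 M.X) (by
            change ((homX f ≫ homX g) ▷ M.X ≫ γ[E.X, M.X]) ≫ 𝟙 M.X =
              A.X ◁ 𝟙 M.X ≫ (homX f ▷ M.X ≫ homX g ▷ M.X ≫ γ[E.X, M.X])
            simp)
        hom_inv_id := Mod.hom_ext _ _ (Category.id_comp (𝟙 M.X))
        inv_hom_id := Mod.hom_ext _ _ (Category.id_comp (𝟙 M.X)) })
    (fun {M N} φ => Mod.hom_ext _ _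
      ((Category.comp_id φ.hom).trans (Category.id_comp φ.hom).symm))

/-- Extension of scalars along a composition. -/
def extendScalarsComp (f : A ⟶ B) (g : B ⟶ E) :
    extendScalars f ⋙ extendScalars g ≅ extendScalars (f ≫ g) :=
  (((extendRestrictAdj f).comp (extendRestrictAdj g)).ofNatIsoRight
    (restrictScalarsComp f g)).leftAdjointUniq (extendRestrictAdj (f ≫ g))

/-- Restriction of scalars along the identity. -/
def restrictScalarsId (A : CommMon C) : 𝟭 (ModOver A) ≅ restrictScalars (𝟙 A) :=
  NatIso.ofComponents
    (fun M =>
      { hom := Mod.Hom.mk' (M := M)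
          (N := (restrictScalars (𝟙 A)).obj M) (𝟙 M.X) (by
            change γ[A.X, M.X] ≫ 𝟙 M.X =
              A.X ◁ 𝟙 M.X ≫ (𝟙 A.X) ▷ M.X ≫ γ[A.X, M.X]
            simp)
        inv := Mod.Hom.mk' (N := M)
          (M := (restrictScalars (𝟙 A)).obj M) (𝟙 M.X) (by
            change ((𝟙 A.X) ▷ M.X ≫ γ[A.X, M.X]) ≫ 𝟙 M.X = A.X ◁ 𝟙 M.X ≫ γ[A.X, M.X]
            simp)
        hom_inv_id := Mod.hom_ext _ _ (Category.id_comp (𝟙 M.X))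
        inv_hom_id := Mod.hom_ext _ _ (Category.id_comp (𝟙 M.X)) })
    (fun {M N} φ => Mod.hom_ext _ _
      ((Category.comp_id φ.hom).trans (Category.id_comp φ.hom).symm))

/-- Extension of scalars along the identity. -/
def extendScalarsId (A : CommMon C) : 𝟭 (ModOver A) ≅ extendScalars (𝟙 A) :=
  (Adjunction.id.ofNatIsoRight (restrictScalarsId A)).leftAdjointUniq (extendRestrictAdj (𝟙 A))

lemma isIso_extendScalars_comp_iff (f : A ⟶ B) (g : B ⟶ E) {M N : ModOver A} (φ : M ⟶ N) :
    IsIso ((extendScalars (f ≫ g)).map φ) ↔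
      IsIso ((extendScalars g).map ((extendScalars f).map φ)) :=
  (NatIso.isIso_map_iff (extendScalarsComp f g) φ).symm

lemma isIso_extendScalars_id_iff {M N : ModOver A} (φ : M ⟶ N) :
    IsIso ((extendScalars (𝟙 A)).map φ) ↔ IsIso φ :=
  (NatIso.isIso_map_iff (extendScalarsId A) φ).symm

instance (f : A ⟶ B) : (restrictScalars f).ReflectsIsomorphisms where
  reflects {M N} φ _ := by
    have : IsIso ((Mod.forget B.X).map φ) :=
      inferInstanceAs (IsIso ((Mod.forget A.X).map ((restrictScalars f).map φ)))
    exact isIso_of_reflects_iso φ (Mod.forget B.X)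

/-- Base change for conservativity: for an `E`-module map `φ`, the extension of scalars of its
restriction along `g : A ⟶ E` is controlled by its extension of scalars to `D = B ⊗_A E`. -/
lemma IsTensorSquare.isIso_iff {f : A ⟶ B} {g : A ⟶ E} {i : B ⟶ D} {j : E ⟶ D}
    (h : IsTensorSquare f g i j) {K K' : ModOver E} (φ : K ⟶ K') :
    IsIso ((extendScalars f).map ((restrictScalars g).map φ)) ↔
      IsIso ((extendScalars j).map φ) := by
  have := h.isIso_baseChange K
  have := h.isIso_baseChange K'
  have e := baseChange_naturality h.w φ
  constructor
  · intro _
    have : IsIso ((restrictScalars i).map ((extendScalars j).map φ)) := by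
      have h2 : IsIso (baseChange K h.w ≫
          (restrictScalars i).map ((extendScalars j).map φ)) := by
        rw [← e]
        infer_instance
      exact IsIso.of_isIso_comp_left (baseChange K h.w) _
    exact isIso_of_reflects_iso _ (restrictScalars i)
  · intro _
    have h2 : IsIso ((extendScalars f).map ((restrictScalars g).map φ) ≫ baseChange K' h.w) := by
      rw [e]
      infer_instance
    exact IsIso.of_isIso_comp_right _ (baseChange K' h.w)

end ScalarsComp

section Topology

variable {C : Type u} [Category.{v} C] [MonoidalCategory C] [SymmetricCategory C]
variable [MonoidalClosed C] [HasColimits C]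

/-- A sieve `S` on `Spec A` is conservative if a morphism of `A`-modules is an isomorphism as
soon as its extensions of scalars along all members of `S` are. -/
def IsConservative {U : Aff C} (S : Sieve U) : Prop :=
  ∀ (M N : ModOver U.unop) (φ : M ⟶ N),
    (∀ (V : Aff C) (j : V ⟶ U), S j → IsIso ((extendScalars j.unop).map φ)) → IsIso φ

/-- Covering sieves for the Zariski topology are universally conservative. For the generating
coverings `A ⟶ A_i` and a morphism `A ⟶ E`, this holds as the `A_i ⊗_A E` form a conservative
family over `E`. -/
lemma isConservative_pullback {U : Aff C} {S : Sieve U} (hS : S ∈ zariskiTopology C U)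
    {V : Aff C} (k : V ⟶ U) : IsConservative (S.pullback k) := by
  replace hS : (zariskiPrecoverage C).Saturate U S := hS
  induction hS generalizing V with
  | of U R hR =>
    obtain ⟨-, n, W, j, hj, hc⟩ := hR
    intro M N φ hφ
    have : IsIso ((restrictScalars k.unop).map φ) := by
      refine hc _ _ _ fun i => ?_
      obtain ⟨D, a, b, h⟩ := exists_isTensorSquare (j i).unop k.unop
      rw [h.isIso_iff]
      -- the sieve contains `Spec D = V ×_U W_i`
      refine hφ (op D) b.op ?_
      refine ⟨W i, a.op, j i, hj i, ?_⟩
      exact Quiver.Hom.unop_inj h.w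
    exact isIso_of_reflects_iso _ (restrictScalars k.unop)
  | top U =>
    intro M N φ hφ
    exact (isIso_extendScalars_id_iff φ).1 (hφ V (𝟙 V) trivial)
  | pullback U S _ W f ih =>
    rw [← Sieve.pullback_comp]
    exact ih _
  | transitive U S R _ _ ih ih' =>
    intro M N φ hφ
    refine ih k _ _ _ fun W j hj => ?_
    have := ih' hj (𝟙 W)
    rw [Sieve.pullback_id] at this
    refine this _ _ _ fun W' l hl => ?_
    have := hφ W' (l ≫ j) (by simpa using hl)
    exact (isIso_extendScalars_comp_iff j.unop l.unop φ).1 this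

lemma isConservative {U : Aff C} {S : Sieve U} (hS : S ∈ zariskiTopology C U) :
    IsConservative S := by
  simpa using isConservative_pullback hS (𝟙 U)

end Topology

/-! ### Affine open subschemes of a scheme -/

section Schemes

variable {C : Type u} [Category.{v} C] [MonoidalCategory C] [SymmetricCategory C]
variable [MonoidalClosed C] [HasColimits C] {X : ZariskiSheaf C}

/-- The sieve of those `W ⟶ V` along which the section `s` of `X` over `V` lifts to one of the
`U i`. -/
def liftSieve {ι : Type w} (U : ι → ZarAff X) {V : Aff C} (s : X.obj.obj (op V)) : Sieve V where
  arrows W k := ∃ i, Presheaf.imageSieve (U i).imm s k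
  downward_closed := by
    rintro Y Z f ⟨i, hi⟩ g
    exact ⟨i, Sieve.downward_closed _ hi g⟩

lemma liftSieve_pullback {ι : Type w} (U : ι → ZarAff X) {V W : Aff C} (s : X.obj.obj (op V))
    (k : W ⟶ V) : (liftSieve U s).pullback k = liftSieve U (X.obj.map k.op s) := by
  ext Y f
  simp [liftSieve, Presheaf.imageSieve]

/-- A section of `X` locally lifts to the members of an affine cover. To see this, the cover is
tested on two morphisms from `X` to the sheaf of closed sieves: one sends a section to the closed
sieve of those restrictions which locally lift, the other one is constant with value the maximal
sieve. They agree on all `U i`. -/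
lemma IsAffineCover.liftSieve_mem {ι : Type w} {U : ι → ZarAff X} (hU : IsAffineCover X U)
    {V : Aff C} (s : X.obj.obj (op V)) : liftSieve U s ∈ zariskiTopology C V := by
  let Z : ZariskiSheaf C := ⟨(Functor.closedSieves (zariskiTopology C)).toFunctor,
    (isSheaf_iff_isSheaf_of_type _ _).2 (classifier_isSheaf (zariskiTopology C))⟩
  let g : X ⟶ Z := ⟨{
    app W := ↾fun t => ⟨(zariskiTopology C).close (liftSieve U t),
      (zariskiTopology C).close_isClosed _⟩
    naturality W W' k := by
      ext t
      apply Subtype.ext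
      change (zariskiTopology C).close (liftSieve U (X.obj.map k t)) =
        ((zariskiTopology C).close (liftSieve U t)).pullback k.unop
      rw [← GrothendieckTopology.pullback_close, liftSieve_pullback]
      rfl }⟩
  let h : X ⟶ Z := ⟨{
    app W := ↾fun t => ⟨(⊤ : Sieve W.unop), (zariskiTopology C).isClosed_iff_close_eq_self _ |>.2
      (((zariskiTopology C).close_eq_top_iff_mem _).2 ((zariskiTopology C).top_mem _))⟩
    naturality W W' k := by
      ext t
      apply Subtype.ext
      exact (Sieve.pullback_top).symm }⟩
  have e := hU Z g h fun i => by
    ext W t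
    apply Subtype.ext
    change (zariskiTopology C).close (liftSieve U ((U i).imm.app W t)) = ⊤
    rw [GrothendieckTopology.close_eq_top_iff_mem]
    refine (zariskiTopology C).superset_covering ?_ ((zariskiTopology C).top_mem _)
    intro Y f _
    refine ⟨i, (uliftYoneda.{u}.obj (U i).obj.left).map f.op t, ?_⟩
    exact ConcreteCategory.congr_hom ((U i).imm.naturality f.op) t
  rw [← GrothendieckTopology.close_eq_top_iff_mem]
  have e2 := congrArg (fun k : X ⟶ Z => (k.hom.app (op V) s).1) e
  exact e2

/-- Morphisms in `ZarAff(X)` are unique: open immersions are monomorphisms. -/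
instance (U V : ZarAff X) : Subsingleton (U ⟶ V) where
  allEq p q := by
    have := V.property.mono
    ext
    apply (uliftYoneda.{u} (C := Aff C)).map_injective
    rw [← cancel_mono V.imm]
    exact (CostructuredArrow.w p.hom).trans (CostructuredArrow.w q.hom).symm

/-- The morphism of affine schemes underlying a morphism of `ZarAff(X)`. -/
abbrev ZarAff.left {U V : ZarAff X} (p : U ⟶ V) : U.obj.left ⟶ V.obj.left := p.hom.left

lemma ZarAff.w {U V : ZarAff X} (p : U ⟶ V) :
    uliftYoneda.{u}.map (ZarAff.left p) ≫ V.imm = U.imm :=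
  CostructuredArrow.w p.hom

/-- Morphisms of affine schemes over `X` are determined by their source and target. -/
lemma ZarAff.hom_ext {W : Aff C} {V : ZarAff X} {k l : W ⟶ V.obj.left}
    (h : uliftYoneda.{u}.map k ≫ V.imm = uliftYoneda.{u}.map l ≫ V.imm) : k = l := by
  have := V.property.mono
  rw [cancel_mono] at h
  exact uliftYoneda.{u}.map_injective h

lemma imageSieve_imm_iff (U V : ZarAff X) {Y : Aff C} (j : Y ⟶ V.obj.left) :
    Presheaf.imageSieve U.imm (uliftYonedaEquiv.{u} V.imm) j ↔
      ∃ t : Y ⟶ U.obj.left, uliftYoneda.{u}.map t ≫ U.imm = uliftYoneda.{u}.map j ≫ V.imm := by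
  have e (t : Y ⟶ U.obj.left) : uliftYonedaEquiv.{u} (uliftYoneda.{u}.map t ≫ U.imm) =
      U.imm.app _ ⟨t⟩ := by
    rw [uliftYonedaEquiv_comp, uliftYonedaEquiv_uliftYoneda_map]
  have e' := uliftYonedaEquiv_naturality V.imm j.op
  constructor
  · rintro ⟨t, ht⟩
    exact ⟨t.down, uliftYonedaEquiv.{u}.injective ((e _).trans (ht.trans e'))⟩
  · rintro ⟨t, ht⟩
    exact ⟨⟨t⟩, (e t).symm.trans ((congrArg uliftYonedaEquiv.{u} ht).trans e'.symm)⟩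

/-- An intersection `W = U ∩ V` of affine open subschemes. -/
structure IsInter {W U V : ZarAff X} (p : W ⟶ U) (q : W ⟶ V) : Prop where
  isPullback : IsPullback (uliftYoneda.{u}.map (ZarAff.left p))
    (uliftYoneda.{u}.map (ZarAff.left q)) U.imm V.imm

namespace IsInter

variable {W U V : ZarAff X} {p : W ⟶ U} {q : W ⟶ V} (h : IsInter p q)
include h

lemma exists_lift_left {Y : Aff C} (a : Y ⟶ U.obj.left) (b : Y ⟶ V.obj.left)
    (w : uliftYoneda.{u}.map a ≫ U.imm = uliftYoneda.{u}.map b ≫ V.imm) :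
    ∃ k : Y ⟶ W.obj.left, k ≫ ZarAff.left p = a ∧ k ≫ ZarAff.left q = b := by
  let k := h.isPullback.lift _ _ w
  obtain ⟨k', hk⟩ := uliftYoneda.{u}.map_surjective k
  refine ⟨k', uliftYoneda.{u}.map_injective ?_, uliftYoneda.{u}.map_injective ?_⟩
  · rw [Functor.map_comp, hk]
    exact h.isPullback.lift_fst _ _ w
  · rw [Functor.map_comp, hk]
    exact h.isPullback.lift_snd _ _ w

/-- `W` is the product of `U` and `V` in `ZarAff(X)`. -/
lemma exists_lift {Y : ZarAff X} (a : Y ⟶ U) (b : Y ⟶ V) : Nonempty (Y ⟶ W) := by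
  obtain ⟨k, hk, -⟩ := h.exists_lift_left (ZarAff.left a) (ZarAff.left b)
    ((ZarAff.w a).trans (ZarAff.w b).symm)
  refine ⟨ObjectProperty.homMk (CostructuredArrow.homMk k ?_)⟩
  have e : uliftYoneda.{u}.map k ≫ W.imm = Y.imm := by
    rw [← ZarAff.w a, ← hk, Functor.map_comp, Category.assoc, ZarAff.w]
  exact e

/-- Base change of an intersection to a smaller affine open: the square of rings of functions on
`U' ∩ V ⟶ U ∩ V` and `U' ⟶ U` is a pushout. -/
lemma isPushout {U' W' : ZarAff X} {p' : W' ⟶ U'} {q' : W' ⟶ V} (h' : IsInter p' q')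
    (u : U' ⟶ U) (k : W' ⟶ W) :
    IsPushout (ZarAff.left u).unop (ZarAff.left p).unop (ZarAff.left p').unop
      (ZarAff.left k).unop := by
  have e1 : k ≫ p = p' ≫ u := Subsingleton.elim _ _
  have e2 : k ≫ q = q' := Subsingleton.elim _ _
  have f1 : ZarAff.left k ≫ ZarAff.left p = ZarAff.left p' ≫ ZarAff.left u :=
    congrArg ZarAff.left e1
  have f2 : ZarAff.left k ≫ ZarAff.left q = ZarAff.left q' := congrArg ZarAff.left e2
  have sq : IsPullback (uliftYoneda.{u}.map (ZarAff.left p'))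
      (uliftYoneda.{u}.map (ZarAff.left k)) (uliftYoneda.{u}.map (ZarAff.left u))
      (uliftYoneda.{u}.map (ZarAff.left p)) := by
    refine IsPullback.of_bot (h₃₁ := V.imm) (v₂₁ := uliftYoneda.{u}.map (ZarAff.left q))
      (v₂₂ := U.imm) ?_ ?_ h.isPullback
    · rw [ZarAff.w, ← Functor.map_comp, f2]
      exact h'.isPullback
    · rw [← Functor.map_comp, ← Functor.map_comp, f1]
  exact (IsPullback.of_map uliftYoneda.{u} f1.symm sq).flip.unop

end IsInter

/-- A family of `U_i ∩ V` for a cover is jointly conservative on `V`. -/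
lemma IsAffineCover.isIso_of_inter {ι : Type w} {U : ι → ZarAff X} (hU : IsAffineCover X U)
    {V : ZarAff X} {W : ι → ZarAff X} {p : ∀ i, W i ⟶ V} {q : ∀ i, W i ⟶ U i}
    (h : ∀ i, IsInter (p i) (q i)) {M N : ModOver V.obj.left.unop} (φ : M ⟶ N)
    (hφ : ∀ i, IsIso ((extendScalars (ZarAff.left (p i)).unop).map φ)) : IsIso φ := by
  refine isConservative (hU.liftSieve_mem (uliftYonedaEquiv.{u} V.imm)) _ _ φ fun Y j ⟨i, hi⟩ => ?_
  obtain ⟨t, ht⟩ := (imageSieve_imm_iff _ _ _).1 hi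
  obtain ⟨k, hk, -⟩ := (h i).exists_lift_left j t ht.symm
  obtain rfl := hk
  exact (isIso_extendScalars_comp_iff (ZarAff.left (p i)).unop k.unop φ).2
    (have := hφ i; inferInstance)

/-- A functor `F` preserves finite limits if its compositions with a jointly conservative family of
left exact functors do: the comparison maps for `F` become isomorphisms. -/
lemma preservesFiniteLimits_of_jointly_conservative {D : Type*} [Category D] {E : Type*}
    [Category E] {ι : Type*} {E' : ι → Type*} [∀ i, Category (E' i)] [HasFiniteLimits D]
    [HasFiniteLimits E] [∀ i, HasFiniteLimits (E' i)] (F : D ⥤ E) (G : ∀ i, E ⥤ E' i)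
    (hG : ∀ {M N : E} (φ : M ⟶ N), (∀ i, IsIso ((G i).map φ)) → IsIso φ)
    [∀ i, PreservesFiniteLimits (G i)] [∀ i, PreservesFiniteLimits (F ⋙ G i)] :
    PreservesFiniteLimits F where
  preservesFiniteLimits J _ _ := ⟨fun {K} => by
    have : IsIso (limit.post K F) := hG _ fun i => by
      have e := limit.post_post K F (G i)
      have h : IsIso ((G i).map (limit.post K F) ≫ limit.post (K ⋙ F) (G i)) := by
        rw [e]
        infer_instance
      exact IsIso.of_isIso_comp_right _ (limit.post (K ⋙ F) (G i))
    exact preservesLimit_of_isIso_post F K⟩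

/-- If `A ⟶ B` is an epimorphism and `A ⟶ B ⟶ E` is flat, then `B ⟶ E` is flat: a `B`-module `K`
satisfies `E ⊗_B K = E ⊗_A K`. -/
lemma isFlat_of_epi_of_comp_eq [HasLimits C] {A B E : CommMon C} {f : A ⟶ B} {l : B ⟶ E}
    {j : A ⟶ E} (hf : Epi f) (w : f ≫ l = j) (hj : IsFlat j) : IsFlat l := by
  have sq : IsPushout j f (𝟙 E) l := by
    refine ⟨⟨by simp [w]⟩, ⟨PushoutCocone.IsColimit.mk _ (fun s => s.inl) (fun s => by simp)
      (fun s => ?_) fun s m h1 _ => by simpa using h1⟩⟩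
    rw [← cancel_epi f, ← s.condition, reassoc_of% w]
  have h := IsTensorSquare.of_isPushout sq
  have := fun K => h.isIso_baseChange K
  let e : restrictScalars f ⋙ extendScalars j ≅ extendScalars l ⋙ restrictScalars (𝟙 E) :=
    NatIso.ofComponents (fun K => asIso (baseChange K h.w))
      (fun φ => baseChange_naturality h.w φ)
  have e' : restrictScalars f ⋙ extendScalars j ≅ extendScalars l :=
    e ≪≫ Functor.isoWhiskerLeft _ (restrictScalarsId E).symm ≪≫ Functor.rightUnitor _
  have : PreservesFiniteLimits (extendScalars j) := hj
  have : PreservesFiniteLimits (restrictScalars f) :=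
    have := (extendRestrictAdj f).rightAdjoint_preservesLimits
    inferInstance
  exact preservesFiniteLimits_of_natIso e'

/-- Restriction between affine open subschemes is flat. The image of `U` in `V` is covered by affine
open immersions `Y ⟶ V`; these factor over `U`, the `Y ⟶ U` are jointly conservative, and they
are flat because `O(V) ⟶ O(U)` is an epimorphism. -/
lemma ZarAff.isFlat [HasLimits C] {U V : ZarAff X} (p : U ⟶ V) : IsFlat (ZarAff.left p).unop := by
  obtain ⟨R, hR, hS⟩ := U.property.isZariskiOpen V.obj.left (uliftYonedaEquiv.{u} V.imm)
  have hmem (Y : Aff C) (j : Y ⟶ V.obj.left) (hj : R j) :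
      ∃ t : Y ⟶ U.obj.left, t ≫ ZarAff.left p = j := by
    have : Presheaf.imageSieve U.imm (uliftYonedaEquiv.{u} V.imm) j := by
      rw [hS]
      exact (zariskiTopology C).le_close _ _ (Sieve.le_generate R _ _ hj)
    obtain ⟨t, ht⟩ := (imageSieve_imm_iff _ _ _).1 this
    refine ⟨t, ZarAff.hom_ext ?_⟩
    rw [← ht, Functor.map_comp, Category.assoc, ZarAff.w]
  have hp : (Sieve.generate R).pullback (ZarAff.left p) ∈ zariskiTopology C U.obj.left := by
    have : Presheaf.imageSieve U.imm (uliftYonedaEquiv.{u} V.imm) (ZarAff.left p) :=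
      (imageSieve_imm_iff _ _ _).2 ⟨𝟙 _, by rw [ZarAff.w]; simp⟩
    rw [hS] at this
    exact this
  have hepi : Epi (ZarAff.left p).unop := by
    have : Mono (ZarAff.left p) := ⟨fun {Z} a b hab => ZarAff.hom_ext (by
      rw [← ZarAff.w p, ← Functor.map_comp_assoc, hab, Functor.map_comp_assoc])⟩
    infer_instance
  let ι := Σ (Y : Aff C), {t : Y ⟶ U.obj.left // R (t ≫ ZarAff.left p)}
  have hflat (i : ι) : IsFlat ((i.2.1 ≫ ZarAff.left p).unop) := (hR _ _ i.2.2).flat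
  have (i : ι) : PreservesFiniteLimits (extendScalars i.2.1.unop) :=
    isFlat_of_epi_of_comp_eq hepi rfl (hflat i)
  have (i : ι) : PreservesFiniteLimits
      (extendScalars (ZarAff.left p).unop ⋙ extendScalars i.2.1.unop) :=
    have : PreservesFiniteLimits (extendScalars ((ZarAff.left p).unop ≫ i.2.1.unop)) := hflat i
    preservesFiniteLimits_of_natIso (extendScalarsComp _ _).symm
  refine preservesFiniteLimits_of_jointly_conservative _
    (fun i : ι => extendScalars i.2.1.unop) fun {M N} φ hφ => ?_
  refine isConservative hp _ _ φ fun Y k ⟨Y', a, b, hb, hab⟩ => ?_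
  obtain ⟨t, ht⟩ := hmem Y' b hb
  have hk : k = a ≫ t := ZarAff.hom_ext (by
    rw [← ZarAff.w p, ← Functor.map_comp_assoc, ← Functor.map_comp_assoc, Category.assoc, ht, hab])
  subst hk
  have := hφ ⟨Y', t, by rwa [ht]⟩
  exact (isIso_extendScalars_comp_iff t.unop a.unop φ).2 inferInstance

end Schemes

/-! ### Extension and contraction of submodules -/

section Submodules

open MonObj ModObj

variable {C : Type u} [Category.{v} C] [Abelian C] [HasLimits C] [HasColimits C]
  [MonoidalCategory C] [SymmetricCategory C] [MonoidalClosed C]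
variable {A B E : CommMon C} {f : A ⟶ B} {g : B ⟶ E} {M : ModOver A} {N : ModOver B}
  {P : ModOver E}

instance {N N' : ModOver B} (a : N ⟶ N') [Mono a] : Mono a.hom :=
  inferInstanceAs (Mono ((Mod.forget B.X).map a))

instance (f : A ⟶ B) : (restrictScalars f).PreservesMonomorphisms :=
  (restrictScalars f).preservesMonomorphisms_of_adjunction (extendRestrictAdj f)

/-- The morphism `h` into the object underlying a module takes values in the submodule `T`. -/
def Contains (T : Subobject N) {Z : C} (h : Z ⟶ N.X) : Prop :=
  ∃ k : Z ⟶ (T : ModOver B).X, k ≫ T.arrow.hom = h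

lemma Contains.precomp {T : Subobject N} {Z Z' : C} {h : Z ⟶ N.X} (H : Contains T h)
    (l : Z' ⟶ Z) : Contains T (l ≫ h) := by
  obtain ⟨k, hk⟩ := H
  exact ⟨l ≫ k, by rw [Category.assoc, hk]⟩

/-- A factorization of `m` through the submodule `T` in `C` is automatically linear. -/
lemma exists_linear_lift (T : Subobject N) (m : M ⟶ (restrictScalars f).obj N)
    (H : Contains T (show M.X ⟶ N.X from m.hom)) :
    ∃ k : M ⟶ (restrictScalars f).obj (T : ModOver B),
      k ≫ (restrictScalars f).map T.arrow = m := by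
  obtain ⟨k, hk⟩ := H
  refine ⟨Mod.Hom.mk' (M := M) (N := (restrictScalars f).obj (T : ModOver B)) k ?_,
    Mod.hom_ext _ _ hk⟩
  change γ[A.X, M.X] ≫ k = A.X ◁ k ≫ homX f ▷ (T : ModOver B).X ≫ γ[B.X, (T : ModOver B).X]
  have e : γ[A.X, M.X] ≫ (show M.X ⟶ N.X from m.hom) =
    A.X ◁ (show M.X ⟶ N.X from m.hom) ≫ homX f ▷ N.X ≫ γ[B.X, N.X] := m.isModHom.smul_hom
  have e' : γ[B.X, (T : ModOver B).X] ≫ T.arrow.hom = B.X ◁ T.arrow.hom ≫ γ[B.X, N.X] :=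
    T.arrow.isModHom.smul_hom
  rw [← cancel_mono T.arrow.hom, Category.assoc, hk, Category.assoc, Category.assoc, e', e,
    ← whisker_exchange_assoc, ← MonoidalCategory.whiskerLeft_comp_assoc, hk]

lemma contains_of_lift {T : Subobject N} {m : M ⟶ (restrictScalars f).obj N}
    {k : M ⟶ (restrictScalars f).obj (T : ModOver B)}
    (h : k ≫ (restrictScalars f).map T.arrow = m) :
    Contains T (show M.X ⟶ N.X from m.hom) :=
  ⟨k.hom, congrArg Mod.Hom.hom h⟩

lemma factors_iff_contains {Q : ModOver B} (T : Subobject N) (φ : Q ⟶ N) :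
    T.Factors φ ↔ Contains T φ.hom := by
  constructor
  · intro h
    exact ⟨(T.factorThru φ h).hom, congrArg Mod.Hom.hom (T.factorThru_arrow φ h)⟩
  · rintro ⟨k, hk⟩
    refine (Subobject.factors_iff _ _).2 ⟨Mod.Hom.mk' k ?_, Mod.hom_ext _ _ hk⟩
    have e' : γ[B.X, (T : ModOver B).X] ≫ T.arrow.hom = B.X ◁ T.arrow.hom ≫ γ[B.X, N.X] :=
      T.arrow.isModHom.smul_hom
    change γ[B.X, Q.X] ≫ k = B.X ◁ k ≫ γ[B.X, (T : ModOver B).X]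
    rw [← cancel_mono T.arrow.hom, Category.assoc, hk, Category.assoc, e',
      ← MonoidalCategory.whiskerLeft_comp_assoc, hk]
    exact φ.isModHom.smul_hom

lemma factors_extLift_iff (T : Subobject N) (m : M ⟶ (restrictScalars f).obj N) :
    T.Factors (extLift f M m) ↔ Contains T (show M.X ⟶ N.X from m.hom) := by
  constructor
  · intro h
    refine contains_of_lift (k := (extendRestrictAdj f).homEquiv _ _ (T.factorThru _ h)) ?_
    rw [← Adjunction.homEquiv_naturality_right, Subobject.factorThru_arrow, Equiv.apply_symm_apply]
  · intro h
    obtain ⟨k, rfl⟩ := exists_linear_lift T m h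
    rw [extLift, Adjunction.homEquiv_naturality_right_symm]
    exact Subobject.factors_comp_arrow _

lemma le_iff_contains {S T : Subobject N} : S ≤ T ↔ Contains T S.arrow.hom := by
  rw [← factors_iff_contains]
  refine ⟨fun h => ?_, fun h => Subobject.le_of_comm (T.factorThru _ h) (by simp)⟩
  exact (Subobject.factors_iff _ _).2 ⟨Subobject.ofLE _ _ h, Subobject.ofLE_arrow h⟩

lemma Contains.mono {S T : Subobject N} (h : S ≤ T) {Z : C} {a : Z ⟶ N.X} (ha : Contains S a) :
    Contains T a := by
  obtain ⟨k, rfl⟩ := ha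
  exact (le_iff_contains.1 h).precomp k

lemma epi_factorThruImageSubobject {D : Type*} [Category D] [Abelian D] {Y Z : D} (a : Y ⟶ Z) :
    Epi (factorThruImageSubobject a) := inferInstance

/-- The submodule of `N` generated by the image of a submodule `S` of `M`, under a semilinear map
`m : M ⟶ N`. -/
def res (m : M ⟶ (restrictScalars f).obj N) (S : Subobject M) : Subobject N :=
  imageSubobject (extLift f (S : ModOver A) (S.arrow ≫ m))

/-- The inverse image of a submodule `T` of `N` under a semilinear map `m : M ⟶ N`. -/
def con (m : M ⟶ (restrictScalars f).obj N) (T : Subobject N) : Subobject M :=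
  (Subobject.pullback m).obj (Subobject.mk ((restrictScalars f).map T.arrow))

/-- The surjection from `B ⊗_A S` to the submodule of `N` generated by `S`. -/
def resπ (m : M ⟶ (restrictScalars f).obj N) (S : Subobject M) :
    (extendScalars f).obj (S : ModOver A) ⟶ (res m S : ModOver B) :=
  factorThruImageSubobject _

instance (m : M ⟶ (restrictScalars f).obj N) (S : Subobject M) : Epi (resπ m S) :=
  epi_factorThruImageSubobject _

lemma resπ_arrow (m : M ⟶ (restrictScalars f).obj N) (S : Subobject M) :
    resπ m S ≫ (res m S).arrow = extLift f (S : ModOver A) (S.arrow ≫ m) :=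
  imageSubobject_arrow_comp _

lemma res_le_iff_factors {m : M ⟶ (restrictScalars f).obj N} {S : Subobject M}
    {T : Subobject N} :
    res m S ≤ T ↔ T.Factors (extLift f (S : ModOver A) (S.arrow ≫ m)) := by
  refine ⟨fun h => ?_, fun h => imageSubobject_le _ (T.factorThru _ h) (by simp)⟩
  exact Subobject.factors_of_le _ h
    ((Subobject.factors_iff _ _).2 ⟨resπ m S, resπ_arrow m S⟩)

lemma res_le_iff_contains {m : M ⟶ (restrictScalars f).obj N} {S : Subobject M}
    {T : Subobject N} :
    res m S ≤ T ↔ Contains T (S.arrow.hom ≫ (show M.X ⟶ N.X from m.hom)) :=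
  res_le_iff_factors.trans (factors_extLift_iff T (S.arrow ≫ m))

lemma contains_con_iff {m : M ⟶ (restrictScalars f).obj N} {T : Subobject N} {Z : C}
    {h : Z ⟶ M.X} : Contains (con m T) h ↔ Contains T (h ≫ (show M.X ⟶ N.X from m.hom)) := by
  let i := (restrictScalars f).map T.arrow
  have sq := (Subobject.isPullback m (Subobject.mk i)).map (Mod.forget A.X)
  let e := Subobject.underlyingIso i
  have e₁ : e.hom.hom ≫ T.arrow.hom = (Subobject.mk i).arrow.hom :=
    congrArg Mod.Hom.hom (Subobject.underlyingIso_hom_comp_eq_mk i)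
  have e₂ : e.inv.hom ≫ (Subobject.mk i).arrow.hom = T.arrow.hom :=
    congrArg Mod.Hom.hom (Subobject.underlyingIso_arrow i)
  constructor
  · rintro ⟨k, rfl⟩
    refine ⟨k ≫ (Subobject.pullbackπ m (Subobject.mk i)).hom ≫ e.hom.hom, ?_⟩
    refine (Category.assoc _ _ _).trans ((congrArg (k ≫ ·) ?_).trans (Category.assoc _ _ _).symm)
    exact (Category.assoc _ _ _).trans ((congrArg (_ ≫ ·) e₁).trans sq.w)
  · rintro ⟨k, hk⟩
    refine ⟨sq.lift (k ≫ e.inv.hom) h ?_, sq.lift_snd _ _ _⟩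
    exact (Category.assoc _ _ _).trans ((congrArg (k ≫ ·) e₂).trans hk)

lemma le_con_iff_contains {m : M ⟶ (restrictScalars f).obj N} {S : Subobject M}
    {T : Subobject N} :
    S ≤ con m T ↔ Contains T (S.arrow.hom ≫ (show M.X ⟶ N.X from m.hom)) := by
  rw [le_iff_contains, contains_con_iff]

/-- Extension and contraction of submodules form a Galois connection. -/
lemma res_le_iff_le_con {m : M ⟶ (restrictScalars f).obj N} {S : Subobject M}
    {T : Subobject N} : res m S ≤ T ↔ S ≤ con m T := by
  rw [res_le_iff_contains, le_con_iff_contains]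

lemma gc_res_con (m : M ⟶ (restrictScalars f).obj N) : GaloisConnection (res m) (con m) :=
  fun _ _ => res_le_iff_le_con

lemma res_sup (m : M ⟶ (restrictScalars f).obj N) (S T : Subobject M) :
    res m (S ⊔ T) = res m S ⊔ res m T :=
  (gc_res_con m).l_sup

lemma con_eq_con_con {f' : A ⟶ E} {m : M ⟶ (restrictScalars f).obj N}
    {n : N ⟶ (restrictScalars g).obj P} {l : M ⟶ (restrictScalars f').obj P}
    (h : l.hom = (show M.X ⟶ N.X from m.hom) ≫ (show N.X ⟶ P.X from n.hom)) (T : Subobject P) :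
    con l T = con m (con n T) := by
  have key (S : Subobject M) : S ≤ con l T ↔ S ≤ con m (con n T) := by
    rw [le_con_iff_contains, le_con_iff_contains, contains_con_iff, Category.assoc]
    exact iff_of_eq (congrArg (fun t => Contains T (S.arrow.hom ≫ t)) h)
  exact le_antisymm ((key _).1 le_rfl) ((key _).2 le_rfl)

lemma res_eq_res_res {f' : A ⟶ E} {m : M ⟶ (restrictScalars f).obj N}
    {n : N ⟶ (restrictScalars g).obj P} {l : M ⟶ (restrictScalars f').obj P}
    (h : l.hom = (show M.X ⟶ N.X from m.hom) ≫ (show N.X ⟶ P.X from n.hom)) (S : Subobject M) :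
    res l S = res n (res m S) := by
  have key (T : Subobject P) : res l S ≤ T ↔ res n (res m S) ≤ T := by
    rw [res_le_iff_le_con, res_le_iff_le_con, res_le_iff_le_con, con_eq_con_con h]
  exact le_antisymm ((key _).2 le_rfl) ((key _).1 le_rfl)

lemma con_of_hom_eq_id {f : A ⟶ A} {m : M ⟶ (restrictScalars f).obj M}
    (h : m.hom = 𝟙 M.X) (T : Subobject M) : con m T = T := by
  have key (S : Subobject M) : S ≤ con m T ↔ S ≤ T := by
    rw [le_con_iff_contains, le_iff_contains]
    exact iff_of_eq (congrArg (Contains T) ((congrArg (S.arrow.hom ≫ ·) h).trans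
      (Category.comp_id _)))
  exact le_antisymm ((key _).1 le_rfl) ((key _).2 le_rfl)

lemma res_of_hom_eq_id {f : A ⟶ A} {m : M ⟶ (restrictScalars f).obj M}
    (h : m.hom = 𝟙 M.X) (S : Subobject M) : res m S = S := by
  have key (T : Subobject M) : res m S ≤ T ↔ S ≤ T := by
    rw [res_le_iff_le_con, con_of_hom_eq_id h]
  exact le_antisymm ((key _).2 le_rfl) ((key _).1 le_rfl)

lemma extLift_arrow_comp (m : M ⟶ (restrictScalars f).obj N) (S : Subobject M) :
    extLift f (S : ModOver A) (S.arrow ≫ m) = (extendScalars f).map S.arrow ≫ extLift f M m :=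
  Adjunction.homEquiv_naturality_left_symm _ _ _

lemma isFinitelyGenerated_res [AB5 C] (m : M ⟶ (restrictScalars f).obj N) {S : Subobject M}
    (hS : IsFinitelyGenerated (S : ModOver A)) :
    IsFinitelyGenerated (res m S : ModOver B) :=
  (hS.extendScalars f).of_epi (resπ m S)

/-- In a square of semilinear maps whose horizontal maps exhibit `Z'` and `N` as extensions of
scalars of `Z` and `M`, the submodule `Z` of `M` generates `Z'`. -/
lemma res_mk_eq {Z : ModOver A} {Z' : ModOver B} {a : Z ⟶ M} [Mono a] {a' : Z' ⟶ N} [Mono a']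
    {n : Z ⟶ (restrictScalars f).obj Z'} (hn : IsIso (extLift f Z n))
    (w : n ≫ (restrictScalars f).map a' = a ≫ m) :
    res m (Subobject.mk a) = Subobject.mk a' := by
  have e : extLift f Z n ≫ a' = (extendScalars f).map a ≫ extLift f M m := by
    rw [extLift, ← Adjunction.homEquiv_naturality_right_symm, w,
      Adjunction.homEquiv_naturality_left_symm]
  apply le_antisymm
  · refine imageSubobject_le _ ((extendScalars f).map (Subobject.underlyingIso a).hom ≫
      extLift f Z n ≫ (Subobject.underlyingIso a').inv) ?_
    rw [Category.assoc, Category.assoc, Subobject.underlyingIso_arrow, e, extLift_arrow_comp,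
      ← Functor.map_comp_assoc, Subobject.underlyingIso_hom_comp_eq_mk]
  · refine Subobject.mk_le_of_comm (inv (extLift f Z n) ≫
      (extendScalars f).map (Subobject.underlyingIso a).inv ≫ resπ m _) ?_
    rw [Category.assoc, Category.assoc, resπ_arrow, extLift_arrow_comp, ← Functor.map_comp_assoc,
      Subobject.underlyingIso_arrow, IsIso.inv_comp_eq, e]

section Flat

/-- The semilinear map `m : M ⟶ N` exhibits `N` as `B ⊗_A M`, and `B` is flat over `A`. -/
structure IsFlatBaseChange (m : M ⟶ (restrictScalars f).obj N) : Prop where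
  isFlat : IsFlat f
  isIso : IsIso (extLift f M m)

lemma IsFlat.mono (hf : IsFlat f) {M N : ModOver A} (φ : M ⟶ N) [Mono φ] :
    Mono ((extendScalars f).map φ) :=
  have : PreservesFiniteLimits (extendScalars f) := hf
  inferInstance

variable {m : M ⟶ (restrictScalars f).obj N} (hm : IsFlatBaseChange m)
include hm

lemma IsFlatBaseChange.mono_extLift {Z : ModOver A} (a : Z ⟶ M) [Mono a] :
    Mono (extLift f Z (a ≫ m)) := by
  have := hm.isFlat.mono a
  have := hm.isIso
  rw [extLift, Adjunction.homEquiv_naturality_left_symm]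
  exact mono_comp _ _

/-- After flat base change, the submodule generated by `S` is `B ⊗_A S`. -/
lemma IsFlatBaseChange.exists_iso_res (S : Subobject M) :
    ∃ e : (extendScalars f).obj (S : ModOver A) ≅ (res m S : ModOver B),
      e.hom ≫ (res m S).arrow = extLift f (S : ModOver A) (S.arrow ≫ m) := by
  have := hm.mono_extLift S.arrow
  have : Mono (resπ m S) := mono_of_mono_fac (resπ_arrow m S)
  have := isIso_of_mono_of_epi (resπ m S)
  exact ⟨asIso (resπ m S), resπ_arrow m S⟩

/-- If `res m S` is finitely generated, it is generated by a finitely generated submodule of `S`: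
it is the union of the submodules generated by the finitely generated submodules of `S`. -/
lemma IsFlatBaseChange.exists_isFinitelyGenerated_le [AB5 C] (hC : LocallyFinitelyGenerated C)
    {S : Subobject M} (hS : IsFinitelyGenerated (res m S : ModOver B)) :
    ∃ T ≤ S, IsFinitelyGenerated (T : ModOver A) ∧ res m T = res m S := by
  obtain ⟨e, he⟩ := hm.exists_iso_res S
  obtain ⟨J, _, _, T, hT, ⟨hc⟩⟩ := hC.mod A.X (S : ModOver A)
  have hadj := (extendRestrictAdj f).leftAdjoint_preservesColimits
  have hS' : IsFinitelyGenerated ((extendScalars f).obj (S : ModOver A)) := hS.of_iso e.symm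
  obtain ⟨j, k, hk⟩ := hS'.exists_factorization
    (F := (T ⋙ Subobject.underlying) ⋙ extendScalars f)
    (fun i j a => by
      have := mono_underlying_map (T.map a)
      exact hm.isFlat.mono (Subobject.underlying.map (T.map a)))
    (isColimitOfPreserves (extendScalars f) hc) (𝟙 _)
  replace hk : k ≫ (extendScalars f).map (T.obj j).arrow = 𝟙 _ := hk
  let i := Subobject.underlyingIso ((T.obj j).arrow ≫ S.arrow)
  have hle : Subobject.mk ((T.obj j).arrow ≫ S.arrow) ≤ S :=
    Subobject.mk_le_of_comm (T.obj j).arrow rfl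
  refine ⟨_, hle, (hT j).of_iso i.symm, le_antisymm ((gc_res_con m).monotone_l hle) ?_⟩
  refine imageSubobject_le _ (k ≫ (extendScalars f).map i.inv ≫ resπ m _) ?_
  rw [Category.assoc, Category.assoc, resπ_arrow, extLift_arrow_comp,
    ← Functor.map_comp_assoc, Subobject.underlyingIso_arrow, Functor.map_comp, Category.assoc,
    reassoc_of% hk, extLift_arrow_comp]

end Flat

/-- A submodule can be compared with another one after a jointly conservative family of flat base
changes. -/
lemma le_of_res_le {I : Type w} {B : I → CommMon C} {f : ∀ i, A ⟶ B i} {N : ∀ i, ModOver (B i)}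
    {m : ∀ i, M ⟶ (restrictScalars (f i)).obj (N i)} (hm : ∀ i, IsFlatBaseChange (m i))
    (hc : ∀ {M' N' : ModOver A} (φ : M' ⟶ N'),
      (∀ i, IsIso ((extendScalars (f i)).map φ)) → IsIso φ)
    {S T : Subobject M} (h : ∀ i, res (m i) S ≤ res (m i) T) : S ≤ T := by
  -- compare `T` with the larger submodule `T ⊔ S`
  have h' (i) : res (m i) (T ⊔ S) ≤ res (m i) T := by
    rw [res_sup]
    exact sup_le le_rfl (h i)
  have hle : T ≤ T ⊔ S := le_sup_left
  suffices IsIso (Subobject.ofLE T (T ⊔ S) hle) from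
    le_sup_right.trans (Subobject.le_of_comm (inv (Subobject.ofLE T (T ⊔ S) hle)) (by simp))
  refine hc _ fun i => ?_
  obtain ⟨e, he⟩ := (hm i).exists_iso_res T
  obtain ⟨e', he'⟩ := (hm i).exists_iso_res (T ⊔ S)
  have : res (m i) T = res (m i) (T ⊔ S) := le_antisymm ((gc_res_con (m i)).monotone_l hle) (h' i)
  have key : (extendScalars (f i)).map (Subobject.ofLE T (T ⊔ S) hle) =
      (e ≪≫ Subobject.isoOfEq _ _ this ≪≫ e'.symm).hom := by
    have := (hm i).mono_extLift (T ⊔ S).arrow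
    rw [← cancel_mono (extLift (f i) _ ((T ⊔ S).arrow ≫ m i)), extLift,
      ← Adjunction.homEquiv_naturality_left_symm, Subobject.ofLE_arrow_assoc, ← extLift, ← extLift,
      ← he, ← he']
    simp
  rw [key]
  infer_instance

/-- Base change for contractions: for a cocartesian square of monoids `A ⟶ B`, `A ⟶ E`, `B ⟶ D`,
`E ⟶ D`, the submodule `S ∩ T` of `M`, with `T` a submodule of `E ⊗_A M`, generates the
submodule `(B S) ∩ (D T)` of `B ⊗_A M`. -/
lemma res_inf_con {E D : CommMon C} {g : A ⟶ E} {i : B ⟶ D} {j : E ⟶ D}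
    (sq : IsTensorSquare f g i j) {P : ModOver E} {Q : ModOver D}
    {m : M ⟶ (restrictScalars f).obj N} {n : M ⟶ (restrictScalars g).obj P}
    {m' : P ⟶ (restrictScalars j).obj Q} {n' : N ⟶ (restrictScalars i).obj Q}
    (hm : IsFlatBaseChange m) (hm' : IsFlatBaseChange m')
    (w : (show M.X ⟶ N.X from m.hom) ≫ (show N.X ⟶ Q.X from n'.hom) =
      (show M.X ⟶ P.X from n.hom) ≫ (show P.X ⟶ Q.X from m'.hom))
    (S : Subobject M) (T : Subobject P) :
    res m (S ⊓ con n T) = res m S ⊓ con n' (res m' T) := by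
  apply le_antisymm
  · refine le_inf ((gc_res_con m).monotone_l inf_le_left) ?_
    rw [res_le_iff_contains, contains_con_iff, Category.assoc]
    have h1 : Contains (con n T) (S ⊓ con n T).arrow.hom := le_iff_contains.1 inf_le_right
    have h2 := (contains_con_iff (m := m')).1
      ((contains_con_iff.1 h1).mono (res_le_iff_le_con.1 (le_refl (res m' T))))
    rw [Category.assoc] at h2
    exact (iff_of_eq (congrArg (fun t => Contains _ ((S ⊓ con n T).arrow.hom ≫ t)) w)).2 h2
  · have := sq.isIso_baseChange (T : ModOver E)
    have := sq.isIso_baseChange P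
    have := hm'.isIso
    have : PreservesFiniteLimits (extendScalars f) := hm.isFlat
    let R := res m S ⊓ con n' (res m' T)
    obtain ⟨e, he⟩ := hm.exists_iso_res S
    obtain ⟨e', he'⟩ := hm'.exists_iso_res T
    obtain ⟨a, ha⟩ : ∃ a : (R : ModOver B) ⟶ (extendScalars f).obj (S : ModOver A),
        a ≫ extLift f (S : ModOver A) (S.arrow ≫ m) = R.arrow :=
      ⟨Subobject.ofLE R _ inf_le_left ≫ e.inv, by simp [← he]⟩
    obtain ⟨k, hk⟩ := exists_linear_lift (res m' T) (R.arrow ≫ n')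
      (le_con_iff_contains.1 (inf_le_right : R ≤ con n' (res m' T)))
    obtain ⟨b, hb⟩ : ∃ b : (R : ModOver B) ⟶
        (restrictScalars i).obj ((extendScalars j).obj (T : ModOver E)),
        b ≫ (restrictScalars i).map (extLift j (T : ModOver E) (T.arrow ≫ m')) = R.arrow ≫ n' :=
      ⟨k ≫ (restrictScalars i).map e'.inv, by
        rw [← hk, Category.assoc, ← Functor.map_comp, ← he', e'.inv_hom_id_assoc]⟩
    -- `R` maps compatibly to `B ⊗_A S` and to `D ⊗_E T = B ⊗_A T`, hence to `B ⊗_A (S ×_P T)`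
    have h₁ : (extendScalars f).map (S.arrow ≫ n) ≫ baseChange P sq.w ≫
        (restrictScalars i).map (extLift j P m') =
          extLift f (S : ModOver A) (S.arrow ≫ m) ≫ n' := by
      apply extObj_hom_ext
      change extUnit f (S : ModOver A) ≫ extMapX f (S.arrow ≫ n) ≫ baseChangeX P sq.w ≫
        extLiftX j P m' = extUnit f (S : ModOver A) ≫ extLiftX f _ (S.arrow ≫ m) ≫ n'.hom
      rw [reassoc_of% (extUnit_naturality f (S.arrow ≫ n)),
        reassoc_of% (extUnit_extLiftX f _ (S.arrow ≫ m))]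
      have e₁ : extUnit f ((restrictScalars g).obj P) ≫ baseChangeX P sq.w ≫ extLiftX j P m' =
          m'.hom := by
        rw [← Category.assoc, extUnit_baseChangeX]
        exact extUnit_extLiftX j P m'
      refine (congrArg ((S.arrow ≫ n).hom ≫ ·) e₁).trans ?_
      exact (Category.assoc _ _ _).trans
        ((congrArg (S.arrow.hom ≫ ·) w).symm.trans (Category.assoc _ _ _).symm)
    have h₂ : (extendScalars f).map ((restrictScalars g).map T.arrow) ≫ baseChange P sq.w ≫
        (restrictScalars i).map (extLift j P m') = baseChange (T : ModOver E) sq.w ≫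
          (restrictScalars i).map (extLift j (T : ModOver E) (T.arrow ≫ m')) := by
      rw [← Category.assoc, baseChange_naturality, Category.assoc, ← Functor.map_comp,
        extLift_arrow_comp]
    have hab : a ≫ (extendScalars f).map (S.arrow ≫ n) =
        (b ≫ inv (baseChange (T : ModOver E) sq.w)) ≫
          (extendScalars f).map ((restrictScalars g).map T.arrow) := by
      rw [← cancel_mono (baseChange P sq.w ≫ (restrictScalars i).map (extLift j P m')),
        Category.assoc, Category.assoc, Category.assoc, h₁, h₂, IsIso.inv_hom_id_assoc, hb,
        reassoc_of% ha]
    obtain ⟨c, hc⟩ : ∃ c, c ≫ (extendScalars f).map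
        (pullback.fst (S.arrow ≫ n) ((restrictScalars g).map T.arrow)) = a :=
      have sq' := (IsPullback.of_hasPullback (S.arrow ≫ n)
        ((restrictScalars g).map T.arrow)).map (extendScalars f)
      ⟨sq'.lift _ _ hab, sq'.lift_fst _ _ hab⟩
    have hK : (S ⊓ con n T).Factors
        (pullback.fst (S.arrow ≫ n) ((restrictScalars g).map T.arrow) ≫ S.arrow) := by
      rw [Subobject.inf_factors]
      refine ⟨Subobject.factors_comp_arrow _, ?_⟩
      rw [factors_iff_contains, contains_con_iff]
      refine ⟨(pullback.snd (S.arrow ≫ n) ((restrictScalars g).map T.arrow)).hom, ?_⟩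
      exact (congrArg Mod.Hom.hom (pullback.condition (f := S.arrow ≫ n)
        (g := (restrictScalars g).map T.arrow))).symm.trans (Category.assoc _ _ _).symm
    refine Subobject.le_of_comm (c ≫ (extendScalars f).map (Subobject.factorThru _ _ hK) ≫
      resπ m _) ?_
    rw [Category.assoc, Category.assoc, resπ_arrow, extLift_arrow_comp, ← Functor.map_comp_assoc,
      Subobject.factorThru_arrow, Functor.map_comp_assoc, reassoc_of% hc, ← extLift_arrow_comp,
      ha]

end Submodules

/-! ### Subobjects of quasi-coherent sheaves -/

namespace QCoh

variable {C : Type u} [Category.{v} C] [Abelian C] [HasLimits C] [HasColimits C]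
  [MonoidalCategory C] [SymmetricCategory C] [MonoidalClosed C]
variable {X : ZariskiSheaf C} {M N : QCoh X}

lemma isFlatBaseChange (M : QCoh X) {U V : (ZarAff X)ᵒᵖ} (u : U ⟶ V) :
    IsFlatBaseChange (M.map u) :=
  ⟨ZarAff.isFlat u.unop, M.isIso u⟩

@[ext]
lemma hom_ext {f g : M ⟶ N} (h : ∀ U, f.app U = g.app U) : f = g :=
  Hom.ext (funext h)

@[simp]
lemma comp_app {P : QCoh X} (f : M ⟶ N) (g : N ⟶ P) (U : (ZarAff X)ᵒᵖ) :
    (f ≫ g).app U = f.app U ≫ g.app U := rfl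

@[simp]
lemma id_app (M : QCoh X) (U : (ZarAff X)ᵒᵖ) : Hom.app (𝟙 M) U = 𝟙 _ := rfl

lemma naturality (f : M ⟶ N) {U V : (ZarAff X)ᵒᵖ} (u : U ⟶ V) :
    M.map u ≫ (restrictScalars ((ZarAff.structureSheaf X).map u)).map (f.app V) =
      f.app U ≫ N.map u :=
  Hom.naturality f u

lemma map_comp_eq (M : QCoh X) {U V W : (ZarAff X)ᵒᵖ} (u : U ⟶ V) (v : V ⟶ W) (w : U ⟶ W) :
    (M.map w).hom = (show (M.obj U).X ⟶ (M.obj V).X from (M.map u).hom) ≫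
      (show (M.obj V).X ⟶ (M.obj W).X from (M.map v).hom) := by
  obtain rfl : w = u ≫ v := Quiver.Hom.unop_inj (Subsingleton.elim _ _)
  exact M.map_comp u v

lemma res_res (M : QCoh X) {U V W : (ZarAff X)ᵒᵖ} (u : U ⟶ V) (v : V ⟶ W) (w : U ⟶ W)
    (S : Subobject (M.obj U)) : res (M.map v) (res (M.map u) S) = res (M.map w) S :=
  (res_eq_res_res (M.map_comp_eq u v w) S).symm

lemma con_con (M : QCoh X) {U V W : (ZarAff X)ᵒᵖ} (u : U ⟶ V) (v : V ⟶ W) (w : U ⟶ W)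
    (S : Subobject (M.obj W)) : con (M.map u) (con (M.map v) S) = con (M.map w) S :=
  (con_eq_con_con (M.map_comp_eq u v w) S).symm

lemma extendScalars_naturality (f : M ⟶ N) {U V : (ZarAff X)ᵒᵖ} (u : U ⟶ V) :
    extLift _ _ (M.map u) ≫ f.app V =
      (extendScalars ((ZarAff.structureSheaf X).map u)).map (f.app U) ≫ extLift _ _ (N.map u) := by
  rw [extLift, extLift, ← Adjunction.homEquiv_naturality_right_symm,
    ← Adjunction.homEquiv_naturality_left_symm, naturality]

section OfFamily

variable (s : ∀ U, Subobject (M.obj U))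
  (hs : ∀ {U V : (ZarAff X)ᵒᵖ} (u : U ⟶ V), res (M.map u) (s U) = s V)
include hs

/-- The restriction maps of `M` restrict to the members of the family. -/
lemma exists_restriction {U V : (ZarAff X)ᵒᵖ} (u : U ⟶ V) :
    ∃ k : (s U : ModOver _) ⟶ (restrictScalars ((ZarAff.structureSheaf X).map u)).obj (s V),
      k ≫ (restrictScalars _).map (s V).arrow = (s U).arrow ≫ M.map u :=
  exists_linear_lift (s V) ((s U).arrow ≫ M.map u) (res_le_iff_contains.1 (hs u).le)

/-- The quasi-coherent sheaf given by a family of submodules of `M` compatible with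
restriction. -/
def ofFamily : QCoh X where
  obj U := (s U : ModOver _)
  map u := (exists_restriction s hs u).choose
  map_id U := by
    have h := congrArg Mod.Hom.hom (exists_restriction s hs (𝟙 U)).choose_spec
    refine (cancel_mono (s U).arrow.hom).1 (h.trans ?_)
    refine (congrArg ((s U).arrow.hom ≫ ·) (M.map_id U)).trans ?_
    exact (Category.comp_id _).trans (Category.id_comp _).symm
  map_comp {U V W} u v := by
    have h₁ := congrArg Mod.Hom.hom (exists_restriction s hs (u ≫ v)).choose_spec
    have h₂ := congrArg Mod.Hom.hom (exists_restriction s hs u).choose_spec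
    have h₃ := congrArg Mod.Hom.hom (exists_restriction s hs v).choose_spec
    refine (cancel_mono (s W).arrow.hom).1 (h₁.trans ?_)
    refine (congrArg ((s U).arrow.hom ≫ ·) (M.map_comp u v)).trans ?_
    refine (Category.assoc _ _ _).symm.trans ((congrArg (· ≫ _) h₂).symm.trans ?_)
    refine (Category.assoc _ _ _).trans ((congrArg (_ ≫ ·) h₃).symm.trans ?_)
    exact (Category.assoc _ _ _).symm
  isIso {U V} u := by
    obtain ⟨e, he⟩ := (M.isFlatBaseChange u).exists_iso_res (s U)
    have : extLift _ _ (exists_restriction s hs u).choose =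
        (e ≪≫ Subobject.isoOfEq _ _ (hs u)).hom := by
      rw [← cancel_mono (s V).arrow, extLift, ← Adjunction.homEquiv_naturality_right_symm,
        (exists_restriction s hs u).choose_spec, ← extLift, ← he]
      simp
    change IsIso (extLift _ _ (exists_restriction s hs u).choose)
    rw [this]
    infer_instance

/-- The inclusion of `ofFamily` into `M`. -/
def ofFamilyι : ofFamily s hs ⟶ M :=
  { app := fun U => (s U).arrow
    naturality := fun u => (exists_restriction s hs u).choose_spec }

instance : Mono (ofFamilyι s hs) where
  right_cancellation f g h := by
    refine hom_ext fun U => ?_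
    have := congrArg (fun k => Hom.app k U) h
    exact (cancel_mono (s U).arrow).1 this

end OfFamily

/-- The zero morphism of quasi-coherent sheaves. -/
def zeroHom (M N : QCoh X) : M ⟶ N :=
  { app := fun U => 0
    naturality := by
      intro U V u
      rw [zero_comp]
      refine Eq.trans (congrArg (M.map u ≫ ·) ?_) comp_zero
      exact (restrictScalars ((ZarAff.structureSheaf X).map u)).map_zero _ _ }

instance {A B : CommMon C} (f : A ⟶ B) : (extendScalars f).PreservesZeroMorphisms :=
  have := (extendRestrictAdj f).isLeftAdjoint
  inferInstance

/-- By flatness, the kernels of a morphism form a compatible family. -/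
lemma res_kernelSubobject (f : M ⟶ N) {U V : (ZarAff X)ᵒᵖ} (u : U ⟶ V) :
    res (M.map u) (kernelSubobject (f.app U)) = kernelSubobject (f.app V) := by
  have e := extendScalars_naturality f u
  have := M.isIso u
  have : PreservesFiniteLimits (extendScalars ((ZarAff.structureSheaf X).map u)) :=
    (M.isFlatBaseChange u).isFlat
  apply le_antisymm
  · refine res_le_iff_factors.2 ?_
    rw [kernelSubobject_factors_iff, extLift_arrow_comp, Category.assoc, e,
      ← Functor.map_comp_assoc, kernelSubobject_arrow_comp, Functor.map_zero, zero_comp]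
  · let F := extendScalars ((ZarAff.structureSheaf X).map u)
    let κ := kernel.ι (f.app V) ≫ inv (extLift _ _ (M.map u))
    have hκ : κ ≫ F.map (f.app U) = 0 := by
      have := N.isIso u
      rw [← cancel_mono (extLift _ _ (N.map u)), Category.assoc, ← e, Category.assoc,
        IsIso.inv_hom_id_assoc, kernel.condition, zero_comp]
    obtain ⟨l, hl⟩ : ∃ l : kernel (f.app V) ⟶ F.obj (kernel (f.app U)),
        l ≫ F.map (kernel.ι (f.app U)) = κ :=
      have l := KernelFork.IsLimit.lift' (KernelFork.mapIsLimit _ (kernelIsKernel (f.app U)) F) κ hκ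
      ⟨l.1, l.2⟩
    refine Subobject.mk_le_of_comm (l ≫ F.map (kernelSubobjectIso (f.app U)).inv ≫
      resπ (M.map u) _) ?_
    rw [Category.assoc, Category.assoc, resπ_arrow, extLift_arrow_comp, ← Functor.map_comp_assoc,
      kernelSubobject_arrow', reassoc_of% hl, Category.assoc, IsIso.inv_hom_id, Category.comp_id]

/-- Monomorphisms of quasi-coherent sheaves are monomorphisms on sections. -/
lemma mono_app (f : M ⟶ N) [Mono f] (U : (ZarAff X)ᵒᵖ) : Mono (f.app U) := by
  let i := ofFamilyι (fun U => kernelSubobject (f.app U)) (res_kernelSubobject f)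
  have : i = zeroHom _ _ := by
    rw [← cancel_mono f]
    refine hom_ext fun V => ?_
    exact (kernelSubobject_arrow_comp (f.app V)).trans zero_comp.symm
  have h : (kernelSubobject (f.app U)).arrow = 0 := congrArg (fun k => Hom.app k U) this
  refine Preadditive.mono_of_kernel_zero ?_
  rw [← kernelSubobject_arrow', h, comp_zero]

lemma exists_lift_of_mono_app {P : QCoh X} {i : N ⟶ M} (hi : ∀ U, Mono (i.app U)) (f : P ⟶ M)
    (h : ∀ U, ∃ k, k ≫ i.app U = f.app U) : ∃ k, k ≫ i = f := by
  choose k hk using h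
  refine ⟨{ app := k, naturality := fun {U V} u => ?_ }, hom_ext hk⟩
  have := hi V
  rw [← cancel_mono ((restrictScalars ((ZarAff.structureSheaf X).map u)).map (i.app V)),
    Category.assoc, Category.assoc, ← Functor.map_comp, hk, naturality, naturality, reassoc_of% hk]

/-- The submodule of `M(U)` formed by the sections of a subobject of `M`. -/
def sec (S : Subobject M) (U : (ZarAff X)ᵒᵖ) : Subobject (M.obj U) :=
  have := mono_app S.arrow U
  Subobject.mk (S.arrow.app U)

/-- The sections of a subobject form a compatible family. -/
lemma res_sec (S : Subobject M) {U V : (ZarAff X)ᵒᵖ} (u : U ⟶ V) :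
    res (M.map u) (sec S U) = sec S V := by
  have := mono_app S.arrow U
  have := mono_app S.arrow V
  exact res_mk_eq ((S : QCoh X).isIso u) (naturality S.arrow u)

/-- The inclusion of subobjects can be tested on sections. -/
lemma le_iff_sec_le {S T : Subobject M} : S ≤ T ↔ ∀ U, sec S U ≤ sec T U := by
  have := mono_app S.arrow
  have := mono_app T.arrow
  constructor
  · intro h U
    refine Subobject.mk_le_mk_of_comm ((Subobject.ofLE S T h).app U) ?_
    rw [← comp_app, Subobject.ofLE_arrow]
  · intro h
    obtain ⟨k, hk⟩ := exists_lift_of_mono_app (i := T.arrow) (mono_app T.arrow) S.arrow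
      fun U => ⟨Subobject.ofMkLEMk _ _ (h U), Subobject.ofMkLEMk_comp (h U)⟩
    exact Subobject.le_of_comm k hk

/-- A compatible family of submodules comes from a subobject. -/
lemma exists_sec_eq (s : ∀ U, Subobject (M.obj U))
    (hs : ∀ {U V : (ZarAff X)ᵒᵖ} (u : U ⟶ V), res (M.map u) (s U) = s V) :
    ∃ S : Subobject M, ∀ U, sec S U = s U := by
  refine ⟨Subobject.mk (ofFamilyι s hs), fun U => ?_⟩
  let e := Subobject.underlyingIso (ofFamilyι s hs)
  have := mono_app (Subobject.mk (ofFamilyι s hs)).arrow U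
  have h1 : e.hom.app U ≫ (s U).arrow = (Subobject.mk (ofFamilyι s hs)).arrow.app U :=
    congrArg (fun k => Hom.app k U) (Subobject.underlyingIso_hom_comp_eq_mk (ofFamilyι s hs))
  have h2 : e.inv.app U ≫ (Subobject.mk (ofFamilyι s hs)).arrow.app U = (s U).arrow :=
    congrArg (fun k => Hom.app k U) (Subobject.underlyingIso_arrow (ofFamilyι s hs))
  exact le_antisymm (Subobject.mk_le_of_comm (e.hom.app U) h1)
    (Subobject.le_mk_of_comm (e.inv.app U) h2)

lemma isFinitelyGenerated_iff_sec (S : Subobject M) : QCoh.IsFinitelyGenerated (S : QCoh X) ↔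
    ∀ U, RelScheme.IsFinitelyGenerated (sec S U : ModOver ((ZarAff.structureSheaf X).obj U)) := by
  have := mono_app S.arrow
  have e (U) : (sec S U : ModOver ((ZarAff.structureSheaf X).obj U)) ≅ (S : QCoh X).obj U :=
    Subobject.underlyingIso (S.arrow.app U)
  exact ⟨fun h U => (h U).of_iso (e U).symm, fun h U => (h U).of_iso (e U)⟩

section Cut

variable (hss : IsSemiSeparated X)
include hss

/-- A submodule `T` of the sections `S(U)` of a subobject `S` of `M` can be extended to a
subobject `S' ≤ S` with `S'(U) = T`: its sections over `V` are the elements of `S(V)` whose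
restriction to `U ∩ V` lies in the restriction of `T`. Hence nothing changes over those `V` for
which `T` and `S` have the same restriction to `U ∩ V`. -/
lemma exists_sec_eq_of_le (S : Subobject M) (U : ZarAff X) {T : Subobject (M.obj (op U))}
    (hT : T ≤ sec S (op U)) : ∃ S' ≤ S, sec S' (op U) = T ∧
      ∀ (V W : ZarAff X) (p : W ⟶ V) (q : W ⟶ U), IsInter p q →
        res (M.map q.op) T = sec S (op W) → sec S' (op V) = sec S (op V) := by
  have hex (V : ZarAff X) : ∃ (W : ZarAff X) (p : W ⟶ V) (q : W ⟶ U), IsInter p q := by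
    obtain ⟨W, p, q, h⟩ := hss V U
    exact ⟨W, p, q, ⟨h⟩⟩
  choose W p q hpq using hex
  let s (V : (ZarAff X)ᵒᵖ) : Subobject (M.obj V) :=
    sec S V ⊓ con (M.map (p V.unop).op) (res (M.map (q V.unop).op) T)
  have hs {V V' : (ZarAff X)ᵒᵖ} (u : V ⟶ V') : res (M.map u) (s V) = s V' := by
    obtain ⟨k⟩ := (hpq V.unop).exists_lift (p V'.unop ≫ u.unop) (q V'.unop)
    have sq := IsTensorSquare.of_isPushout ((hpq V.unop).isPushout (hpq V'.unop) u.unop k)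
    have key := res_inf_con (f := (ZarAff.structureSheaf X).map u)
      (g := (ZarAff.structureSheaf X).map (p V.unop).op)
      (i := (ZarAff.structureSheaf X).map (p V'.unop).op)
      (j := (ZarAff.structureSheaf X).map k.op) sq
      (n := M.map (p V.unop).op) (n' := M.map (p V'.unop).op)
      (M.isFlatBaseChange u) (M.isFlatBaseChange k.op)
      ((M.map_comp_eq u (p V'.unop).op ((p V'.unop ≫ u.unop).op)).symm.trans
        (M.map_comp_eq (p V.unop).op k.op _)) (sec S V) (res (M.map (q V.unop).op) T)
    rw [res_sec, M.res_res (q V.unop).op k.op (q V'.unop).op] at key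
    exact key
  obtain ⟨S', hS'⟩ := exists_sec_eq s hs
  refine ⟨S', ?_, ?_, ?_⟩
  · rw [le_iff_sec_le]
    intro V
    rw [hS']
    exact inf_le_left
  · rw [hS']
    apply le_antisymm
    -- the two projections `U ∩ U ⟶ U` agree, and they are split by the diagonal `r`
    · obtain ⟨r⟩ := (hpq U).exists_lift (𝟙 U) (𝟙 U)
      have h1 : res (M.map (q U).op) T ≤ con (M.map r.op) T := by
        rw [← res_le_iff_le_con, M.res_res (q U).op r.op (𝟙 _), res_of_hom_eq_id (M.map_id _)]
      refine inf_le_right.trans (((gc_res_con _).monotone_u h1).trans ?_)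
      rw [M.con_con (p U).op r.op (𝟙 _), con_of_hom_eq_id (M.map_id _)]
    · refine le_inf hT ?_
      rw [← res_le_iff_le_con]
      have h : p U = q U := Subsingleton.elim _ _
      change res (M.map (p U).op) T ≤ res (M.map (q U).op) T
      rw [h]
  · intro V W' p' q' h' hres
    rw [hS']
    refine le_antisymm inf_le_left (le_inf le_rfl ?_)
    obtain ⟨k⟩ := h'.exists_lift (p V) (q V)
    change sec S (op V) ≤ con (M.map (p V).op) (res (M.map (q V).op) T)
    rw [← res_le_iff_le_con, ← M.res_res q'.op k.op (q V).op, hres, res_sec, res_sec]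

end Cut

end QCoh

/-! ### Finitely generated quasi-coherent submodules -/

section FiniteFamilies

variable {C : Type u} [Category.{v} C] [Abelian C] [HasLimits C] [HasColimits C]
  [MonoidalCategory C] [SymmetricCategory C] [MonoidalClosed C] [AB5 C]

lemma LocallyFinitelyGenerated.exists_le {A : CommMon C} {M : ModOver A}
    (hC : LocallyFinitelyGenerated C) (S : Subobject M) :
    ∃ T ≤ S, IsFinitelyGenerated (T : ModOver A) := by
  obtain ⟨J, _, _, T, hT, -⟩ := hC.mod A.X (S : ModOver A)
  obtain ⟨j⟩ := IsFiltered.nonempty (C := J)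
  exact ⟨Subobject.mk ((T.obj j).arrow ≫ S.arrow), Subobject.mk_le_of_comm (T.obj j).arrow rfl,
    (hT j).of_iso (Subobject.underlyingIso _).symm⟩

/-- If finitely many flat base changes of `S` are finitely generated, then they are all generated by
one finitely generated submodule of `S`. -/
lemma exists_isFinitelyGenerated_res_eq (hC : LocallyFinitelyGenerated C) {I : Type w} [Finite I]
    {A : CommMon C} {M : ModOver A} {B : I → CommMon C} {f : ∀ i, A ⟶ B i}
    {N : ∀ i, ModOver (B i)} {m : ∀ i, M ⟶ (restrictScalars (f i)).obj (N i)}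
    (hm : ∀ i, IsFlatBaseChange (m i)) {S : Subobject M}
    (hS : ∀ i, IsFinitelyGenerated (res (m i) S : ModOver (B i))) :
    ∃ T ≤ S, IsFinitelyGenerated (T : ModOver A) ∧ ∀ i, res (m i) T = res (m i) S := by
  classical
  have := Fintype.ofFinite I
  suffices h : ∀ s : Finset I, ∃ T ≤ S, IsFinitelyGenerated (T : ModOver A) ∧
      ∀ i ∈ s, res (m i) T = res (m i) S by
    obtain ⟨T, hT, hfg, h⟩ := h Finset.univ
    exact ⟨T, hT, hfg, fun i => h i (Finset.mem_univ i)⟩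
  intro s
  induction s using Finset.induction_on with
  | empty =>
    obtain ⟨T, hT, hfg⟩ := hC.exists_le S
    exact ⟨T, hT, hfg, by simp⟩
  | insert i s _ ih =>
    obtain ⟨T, hT, hfg, h⟩ := ih
    obtain ⟨T', hT', hfg', h'⟩ := (hm i).exists_isFinitelyGenerated_le hC (hS i)
    refine ⟨T ⊔ T', sup_le hT hT', hfg.sup hfg', fun j hj => ?_⟩
    refine le_antisymm ((gc_res_con _).monotone_l (sup_le hT hT')) ?_
    rw [res_sup]
    obtain rfl | hj := Finset.mem_insert.1 hj
    · exact h'.ge.trans le_sup_right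
    · exact (h j hj).ge.trans le_sup_left

end FiniteFamilies

namespace QCoh

variable {C : Type u} [Category.{v} C] [Abelian C] [HasLimits C] [HasColimits C]
  [MonoidalCategory C] [SymmetricCategory C] [MonoidalClosed C]
variable {X : ZariskiSheaf C} {M N : QCoh X}

/-- The sections of `S` over `U` form a finitely generated module. -/
abbrev IsFinitelyGeneratedOn (S : Subobject M) (U : ZarAff X) : Prop :=
  RelScheme.IsFinitelyGenerated
    (sec S (op U) : ModOver ((ZarAff.structureSheaf X).obj (op U)))

variable (hss : IsSemiSeparated X)
include hss

lemma exists_isInter (U V : ZarAff X) :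
    ∃ (W : ZarAff X) (p : W ⟶ U) (q : W ⟶ V), IsInter p q := by
  obtain ⟨W, p, q, h⟩ := hss U V
  exact ⟨W, p, q, ⟨h⟩⟩

/-- Submodules of the sections over `V` can be compared on the members of an affine cover. -/
lemma le_of_cover {I : Type w} {U : I → ZarAff X} (hU : IsAffineCover X U) (V : ZarAff X)
    {S T : Subobject (M.obj (op V))}
    (h : ∀ (i : I) (W : ZarAff X) (p : W ⟶ V) (_ : W ⟶ U i),
      res (M.map p.op) S ≤ res (M.map p.op) T) : S ≤ T := by
  choose W p q hpq using fun i => exists_isInter hss V (U i)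
  exact le_of_res_le (fun i => M.isFlatBaseChange (p i).op)
    (fun φ hφ => hU.isIso_of_inter hpq φ hφ) fun i => h i (W i) (p i) (q i)

lemma le_of_sec_le_of_cover {I : Type w} {U : I → ZarAff X} (hU : IsAffineCover X U)
    {S T : Subobject M} (h : ∀ i, sec S (op (U i)) ≤ sec T (op (U i))) : S ≤ T := by
  rw [le_iff_sec_le]
  intro V
  refine le_of_cover hss hU V.unop fun i W p q => ?_
  have e (R : Subobject M) : res (M.map p.op) (sec R V) = res (M.map q.op) (sec R (op (U i))) :=
    (res_sec R p.op).trans (res_sec R q.op).symm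
  exact (e S).le.trans (((gc_res_con _).monotone_l (h i)).trans (e T).ge)

variable [AB5 C] (hC : LocallyFinitelyGenerated C)
include hC

/-- Finite generation can be checked on a finite affine cover: a finitely generated submodule of
`S(V)` which generates all `S(V ∩ U_i)` is equal to `S(V)`. -/
lemma isFinitelyGenerated_of_cover {I : Type w} [Finite I] {U : I → ZarAff X}
    (hU : IsAffineCover X U) {S : Subobject M} (h : ∀ i, IsFinitelyGeneratedOn S (U i)) :
    QCoh.IsFinitelyGenerated (S : QCoh X) := by
  rw [isFinitelyGenerated_iff_sec]
  intro V
  choose W p q hpq using fun i => exists_isInter hss V.unop (U i)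
  obtain ⟨T, hT, hfg, hres⟩ := exists_isFinitelyGenerated_res_eq hC
    (fun i => M.isFlatBaseChange (p i).op) (S := sec S V) fun i => by
      have e : res (M.map (p i).op) (sec S V) = res (M.map (q i).op) (sec S (op (U i))) :=
        (res_sec S (p i).op).trans (res_sec S (q i).op).symm
      rw [e]
      exact isFinitelyGenerated_res _ (h i)
  have : sec S V ≤ T := le_of_res_le (fun i => M.isFlatBaseChange (p i).op)
    (fun φ hφ => hU.isIso_of_inter hpq φ hφ) fun i => (hres i).ge
  rwa [le_antisymm this hT]

/-- A subobject `S` can be shrunk so as to become finitely generated on finitely many affine open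
subschemes, without changing it where it already is finitely generated. -/
lemma exists_isFinitelyGeneratedOn (L : List (ZarAff X)) (S : Subobject M) (L₀ : List (ZarAff X))
    (h : ∀ V ∈ L₀, IsFinitelyGeneratedOn S V) :
    ∃ S' ≤ S, (∀ V ∈ L₀, sec S' (op V) = sec S (op V)) ∧ ∀ V ∈ L, IsFinitelyGeneratedOn S' V := by
  induction L generalizing S L₀ with
  | nil => exact ⟨S, le_rfl, fun _ _ => rfl, by simp⟩
  | cons U L ih =>
    choose W p q hpq using fun V => exists_isInter hss V U
    have e (V : ZarAff X) : res (M.map (q V).op) (sec S (op U)) =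
        res (M.map (p V).op) (sec S (op V)) :=
      (res_sec S (q V).op).trans (res_sec S (p V).op).symm
    have : Finite {V // V ∈ L₀} := L₀.finite_toSet
    obtain ⟨T, hT, hfg, hres⟩ := exists_isFinitelyGenerated_res_eq hC (I := {V // V ∈ L₀})
      (fun V => M.isFlatBaseChange (q V).op) (S := sec S (op U)) fun V => by
        rw [e]
        exact isFinitelyGenerated_res _ (h V V.2)
    obtain ⟨S₁, hS₁, hU, hV⟩ := exists_sec_eq_of_le hss S U hT
    have hV' (V : ZarAff X) (hV₀ : V ∈ L₀) : sec S₁ (op V) = sec S (op V) :=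
      hV V (W V) (p V) (q V) (hpq V) ((hres ⟨V, hV₀⟩).trans (res_sec S (q V).op))
    obtain ⟨S', hS', h₁, h₂⟩ := ih S₁ (U :: L₀) (by
      rintro V (_ | ⟨_, hV₀⟩)
      · change RelScheme.IsFinitelyGenerated _
        rwa [hU]
      · change RelScheme.IsFinitelyGenerated _
        rw [hV' V hV₀]
        exact h V hV₀)
    refine ⟨S', hS'.trans hS₁, fun V hV₀ => ?_, ?_⟩
    · rw [h₁ V (List.mem_cons_of_mem _ hV₀), hV' V hV₀]
    · rintro V (_ | ⟨_, hV₀⟩)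
      · change RelScheme.IsFinitelyGenerated _
        rw [h₁ U (List.mem_cons_self), hU]
        exact hfg
      · exact h₂ V hV₀

/-- Every finitely generated submodule of `M(V)` is contained in the sections of a finitely
generated quasi-coherent submodule of `M`. -/
lemma exists_isFinitelyGenerated {n : ℕ} {U : Fin n → ZarAff X} (hU : IsAffineCover X U)
    (V : ZarAff X) {T : Subobject (M.obj (op V))}
    (hT : RelScheme.IsFinitelyGenerated (T : ModOver ((ZarAff.structureSheaf X).obj (op V)))) :
    ∃ S : Subobject M, QCoh.IsFinitelyGenerated (S : QCoh X) ∧ T ≤ sec S (op V) := by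
  have htop : T ≤ sec (⊤ : Subobject M) (op V) := by
    have := mono_app (⊤ : Subobject M).arrow (op V)
    refine Subobject.le_mk_of_comm (T.arrow ≫ (inv (⊤ : Subobject M).arrow).app (op V)) ?_
    rw [Category.assoc, ← comp_app, IsIso.inv_hom_id, id_app, Category.comp_id]
  obtain ⟨S₁, -, hS₁, -⟩ := exists_sec_eq_of_le hss ⊤ V htop
  obtain ⟨S, -, h₁, h₂⟩ := exists_isFinitelyGeneratedOn hss hC (List.ofFn U) S₁ [V] (by
    intro V' hV'
    obtain rfl := List.mem_singleton.1 hV'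
    change RelScheme.IsFinitelyGenerated _
    rwa [hS₁])
  refine ⟨S, isFinitelyGenerated_of_cover hss hC hU fun i => h₂ _ (by simp), ?_⟩
  rw [h₁ V (by simp), hS₁]

omit hss hC in
lemma exists_isFinitelyGenerated_sup {S T : Subobject M}
    (hS : QCoh.IsFinitelyGenerated (S : QCoh X)) (hT : QCoh.IsFinitelyGenerated (T : QCoh X)) :
    ∃ R : Subobject M, QCoh.IsFinitelyGenerated (R : QCoh X) ∧ S ≤ R ∧ T ≤ R := by
  obtain ⟨R, hR⟩ := exists_sec_eq (fun U => sec S U ⊔ sec T U) fun u => by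
    rw [res_sup, res_sec, res_sec]
  refine ⟨R, ?_, ?_, ?_⟩
  · rw [isFinitelyGenerated_iff_sec] at hS hT ⊢
    intro U
    rw [hR]
    exact (hS U).sup (hT U)
  · rw [le_iff_sec_le]
    intro U
    rw [hR]
    exact le_sup_left
  · rw [le_iff_sec_le]
    intro U
    rw [hR]
    exact le_sup_right

/-- The finitely generated quasi-coherent submodules of `M` are directed. -/
lemma isFiltered {n : ℕ} {U : Fin n → ZarAff X} (hU : IsAffineCover X U) :
    IsFiltered (SubobjectsWith QCoh.IsFinitelyGenerated M) where
  cocone_objs S T := by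
    obtain ⟨R, hR, hSR, hTR⟩ := exists_isFinitelyGenerated_sup S.property T.property
    exact ⟨⟨R, hR⟩, ObjectProperty.homMk (homOfLE hSR), ObjectProperty.homMk (homOfLE hTR),
      trivial⟩
  cocone_maps S T f g := ⟨T, 𝟙 T, ObjectProperty.hom_ext _ (Subsingleton.elim _ _)⟩
  nonempty := by
    obtain ⟨S, -, -, h⟩ := exists_isFinitelyGeneratedOn hss hC (List.ofFn U) (⊤ : Subobject M) []
      (by simp)
    exact ⟨⟨S, isFinitelyGenerated_of_cover hss hC hU fun i => h _ (by simp)⟩⟩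

/-- There is a small cofinal system of finitely generated quasi-coherent submodules, indexed by
tuples of finitely generated submodules of the sections over the members of a finite cover. -/
lemma finallySmall {n : ℕ} {U : Fin n → ZarAff X} (hU : IsAffineCover X U) :
    FinallySmall.{v} (SubobjectsWith QCoh.IsFinitelyGenerated M) := by
  have := isFiltered hss hC hU (M := M)
  choose J _ _ T hT hc using fun i => hC.mod ((ZarAff.structureSheaf X).obj (op (U i))).X
    (M.obj (op (U i)))
  have h (i : Fin n) (j : J i) : ∃ S : SubobjectsWith QCoh.IsFinitelyGenerated M,
      (T i).obj j ≤ sec S.obj (op (U i)) := by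
    obtain ⟨S, hS, h⟩ := exists_isFinitelyGenerated hss hC hU (U i) (hT i j)
    exact ⟨⟨S, hS⟩, h⟩
  choose S hS using h
  have h (t : ∀ i, J i) : ∃ R : SubobjectsWith QCoh.IsFinitelyGenerated M,
      ∀ i, (S i (t i)).obj ≤ R.obj := by
    classical
    obtain ⟨R, hR⟩ := IsFiltered.sup_objs_exists (Finset.univ.image fun i => S i (t i))
    refine ⟨R, fun i => ?_⟩
    obtain ⟨f⟩ := hR (Finset.mem_image_of_mem (fun i => S i (t i)) (Finset.mem_univ i))
    exact leOfHom f.hom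
  choose R hR using h
  have : Small.{v} (Set.range R) := small_range R
  let P : ObjectProperty (SubobjectsWith QCoh.IsFinitelyGenerated M) := (· ∈ Set.range R)
  have : Small.{v} P.FullSubcategory := small_of_injective (f := fun Q : P.FullSubcategory =>
    (⟨Q.obj, Q.property⟩ : Set.range R)) fun Q Q' h => by
      ext : 1
      exact congrArg Subtype.val h
  have : LocallySmall.{v} P.FullSubcategory :=
    ⟨fun Q Q' =>
      have : Subsingleton (Q ⟶ Q') := ⟨fun a b => by ext : 2; exact Subsingleton.elim _ _⟩
      small_subsingleton _⟩
  suffices h : ∀ Q, ∃ Q', P Q' ∧ Nonempty (Q ⟶ Q') by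
    have : P.ι.Final := Functor.final_of_exists_of_isFiltered_of_fullyFaithful _ fun Q => by
      obtain ⟨Q', h, h'⟩ := h Q
      exact ⟨⟨Q', h⟩, h'⟩
    have := essentiallySmall_of_small_of_locallySmall.{v} P.FullSubcategory
    exact finallySmall_of_final_of_essentiallySmall P.ι
  intro Q
  have h (i : Fin n) : ∃ j, sec Q.obj (op (U i)) ≤ (T i).obj j := by
    have hQ := (isFinitelyGenerated_iff_sec Q.obj).1 Q.property (op (U i))
    obtain ⟨j, k, hk⟩ := hQ.exists_factorization (fun i' j f => mono_underlying_map ((T i).map f))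
      (hc i).some (sec Q.obj (op (U i))).arrow
    exact ⟨j, Subobject.le_of_comm k hk⟩
  choose t ht using h
  refine ⟨R t, ⟨t, rfl⟩, ⟨ObjectProperty.homMk (homOfLE ?_)⟩⟩
  exact le_of_sec_le_of_cover hss hU fun i =>
    (ht i).trans ((hS i (t i)).trans (le_iff_sec_le.1 (hR t i) _))

section Colimit

variable (c : Cocone (subobjectsWithDiagram (QCoh.IsFinitelyGenerated (X := X)) M))

omit hss hC in
/-- A map into the sections of a finitely generated submodule of `M`, followed by the leg of a
cocone, only depends on the composite map to the sections of `M`. -/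
lemma comp_ι_eq {V : (ZarAff X)ᵒᵖ} {S T : SubobjectsWith QCoh.IsFinitelyGenerated M}
    {Z : ModOver ((ZarAff.structureSheaf X).obj V)} {a : Z ⟶ (S.obj : QCoh X).obj V}
    {b : Z ⟶ (T.obj : QCoh X).obj V} (h : a ≫ S.obj.arrow.app V = b ≫ T.obj.arrow.app V) :
    a ≫ (c.ι.app S).app V = b ≫ (c.ι.app T).app V := by
  obtain ⟨R, hR, hSR, hTR⟩ := exists_isFinitelyGenerated_sup S.property T.property
  let R' : SubobjectsWith QCoh.IsFinitelyGenerated M := ⟨R, hR⟩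
  have e₁ : c.ι.app S = Subobject.ofLE _ _ hSR ≫ c.ι.app R' :=
    (c.w (ObjectProperty.homMk (homOfLE hSR) : S ⟶ R')).symm
  have e₂ : c.ι.app T = Subobject.ofLE _ _ hTR ≫ c.ι.app R' :=
    (c.w (ObjectProperty.homMk (homOfLE hTR) : T ⟶ R')).symm
  have := mono_app R.arrow V
  have e₃ : a ≫ (Subobject.ofLE _ _ hSR).app V = b ≫ (Subobject.ofLE _ _ hTR).app V := by
    rw [← cancel_mono (R.arrow.app V), Category.assoc, Category.assoc, ← comp_app, ← comp_app,
      Subobject.ofLE_arrow, Subobject.ofLE_arrow, h]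
  rw [e₁, e₂, comp_app, comp_app, reassoc_of% e₃]

variable {n : ℕ} {U : Fin n → ZarAff X} (hU : IsAffineCover X U)
include hU

/-- The inclusions of the finitely generated quasi-coherent submodules are jointly epimorphic on
sections, and every cocone factors over the sections of `M`. -/
lemma exists_desc_app (V : (ZarAff X)ᵒᵖ) :
    (∃ d : M.obj V ⟶ c.pt.obj V, ∀ S : SubobjectsWith QCoh.IsFinitelyGenerated M,
      S.obj.arrow.app V ≫ d = (c.ι.app S).app V) ∧
    ∀ (Z : ModOver ((ZarAff.structureSheaf X).obj V)) (d d' : M.obj V ⟶ Z),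
      (∀ S : SubobjectsWith QCoh.IsFinitelyGenerated M,
        S.obj.arrow.app V ≫ d = S.obj.arrow.app V ≫ d') → d = d' := by
  obtain ⟨J, _, _, T, hT, ⟨hc⟩⟩ := hC.mod ((ZarAff.structureSheaf X).obj V).X (M.obj V)
  have h (j : J) : ∃ (S : SubobjectsWith QCoh.IsFinitelyGenerated M)
      (a : (T.obj j : ModOver ((ZarAff.structureSheaf X).obj V)) ⟶ (S.obj : QCoh X).obj V),
      a ≫ S.obj.arrow.app V = (T.obj j).arrow := by
    obtain ⟨S, hS, h⟩ := exists_isFinitelyGenerated hss hC hU V.unop (hT j)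
    have := mono_app S.arrow V
    exact ⟨⟨S, hS⟩, Subobject.ofLEMk _ _ h, Subobject.ofLEMk_comp h⟩
  choose S a ha using h
  refine ⟨?_, fun Z d d' h => hc.hom_ext fun j => ?_⟩
  · let t : Cocone (T ⋙ Subobject.underlying) :=
      { pt := c.pt.obj V
        ι :=
          { app := fun j => a j ≫ (c.ι.app (S j)).app V
            naturality := fun i j f => by
              change _ = (a i ≫ (c.ι.app (S i)).app V) ≫ 𝟙 _
              rw [Category.comp_id, ← Category.assoc]
              refine comp_ι_eq c ?_
              rw [Category.assoc, ha, ha]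
              exact Subobject.underlying_arrow _ } }
    obtain ⟨d, hd⟩ : ∃ d : M.obj V ⟶ c.pt.obj V,
        ∀ j, (T.obj j).arrow ≫ d = a j ≫ (c.ι.app (S j)).app V := ⟨hc.desc t, hc.fac t⟩
    refine ⟨d, fun R => ?_⟩
    obtain ⟨j, k, hk⟩ : ∃ (j : J) (k : (R.obj : QCoh X).obj V ⟶
        (T.obj j : ModOver ((ZarAff.structureSheaf X).obj V))),
        k ≫ (T.obj j).arrow = R.obj.arrow.app V :=
      (R.property V).exists_factorization (fun i j f => mono_underlying_map (T.map f)) hc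
        (R.obj.arrow.app V)
    rw [← hk, Category.assoc, hd, ← Category.assoc, ← Category.id_comp ((c.ι.app R).app V)]
    refine comp_ι_eq c ?_
    rw [Category.assoc, ha, hk]
    exact (Category.id_comp _).symm
  · change (T.obj j).arrow ≫ d = (T.obj j).arrow ≫ d'
    rw [← ha, Category.assoc, Category.assoc, h]

omit c in
/-- `M` is the colimit of its finitely generated quasi-coherent submodules. -/
lemma nonempty_isColimit :
    Nonempty (IsColimit (subobjectsWithCocone (QCoh.IsFinitelyGenerated (X := X)) M)) := by
  choose d hd using fun
    (c : Cocone (subobjectsWithDiagram (QCoh.IsFinitelyGenerated (X := X)) M)) V =>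
      (exists_desc_app hss hC c hU V).1
  have hext (V) := (exists_desc_app hss hC
    (subobjectsWithCocone (QCoh.IsFinitelyGenerated (X := X)) M) hU V).2
  refine ⟨{ desc := fun c => { app := d c, naturality := fun {V V'} u => ?_ },
            fac := fun c S => ?_, uniq := fun c k hk => ?_ }⟩
  · have key (S : SubobjectsWith QCoh.IsFinitelyGenerated M) :
        S.obj.arrow.app V ≫ M.map u ≫
            (restrictScalars ((ZarAff.structureSheaf X).map u)).map (d c V') =
          S.obj.arrow.app V ≫ d c V ≫ c.pt.map u := by
      rw [← reassoc_of% (naturality S.obj.arrow u), ← Functor.map_comp, hd, reassoc_of% (hd c V S)]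
      exact naturality (c.ι.app S) u
    exact hext V _ _ _ key
  · exact hom_ext fun V => hd c V S
  · refine hom_ext fun V => hext V _ _ _ fun S => ?_
    exact (congrArg (fun l => Hom.app l V) (hk S)).trans (hd c V S).symm

end Colimit

end QCoh

end RelScheme

end

theorem theorem3p8 {C : Type u} [Category.{v} C] [Abelian C] [HasLimits C] [HasColimits C]
    [MonoidalCategory C] [SymmetricCategory C] [MonoidalClosed C]
    [AB5 C]
    (hC1 : ∀ M : C,
      RelScheme.IsDirectedColimitOfSubobjects.{v} RelScheme.IsFinitelyGenerated M)
    (X : RelScheme.ZariskiSheaf C) (hX : RelScheme.IsScheme X)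
    (hqc : RelScheme.IsQuasiCompact X) (hss : RelScheme.IsSemiSeparated X)
    (M : RelScheme.QCoh X) :
    RelScheme.IsDirectedColimitOfSubobjects.{v} RelScheme.QCoh.IsFinitelyGenerated M := by
  have hC := RelScheme.locallyFinitelyGenerated_of_isDirectedColimit hC1
  obtain ⟨I, U, hU⟩ := hX
  obtain ⟨s, hs⟩ := hqc I U hU
  have hU' : RelScheme.IsAffineCover X fun i : Fin s.card => U (s.equivFin.symm i) :=
    fun Z g h hgh => hs Z g h fun i => by
      obtain ⟨k, rfl⟩ := s.equivFin.symm.surjective i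
      exact hgh k
  exact ⟨RelScheme.QCoh.isFiltered hss hC hU', RelScheme.QCoh.finallySmall hss hC hU',
    RelScheme.QCoh.nonempty_isColimit hss hC hU'⟩
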